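/- **Setting.** Fix $n\in\mathbb N$ and let $d(x,y)=\max_i|x_i-y_i|$ on $\mathbb R^n$, with open balls $B_L(x)$ (cubes of side $2L$). A *discrete operator* $H$ in dimension $n$ is a bounded operator on a nonzero complex Hilbert space together with an orthonormal basis $(e_x)_{x\in\Gamma}$ indexed by a uniformly discrete set $\Gamma\subset\mathbb R^n$ (there is $q>0$ with $d(x,y)>q$ for all distinct $x,y\in\Gamma$); put $H_{xy}=\langle e_x,He_y\rangle$. It is *short-range* if there are $C$ and $\eta>0$ with $|H_{xy}|\le C\,d(x,y)^{-(n+\eta)}$ for all distinct $x,y\in\Gamma$. For $A,B\subseteq\Gamma$, $H$ *has equivalent action on $A$ and $B$ via $t\in\mathbb R^n$* if $B=t+A$ and there are $U(a)\in\mathbb C$, $|U(a)|=1$ $(a\in A)$, with $H_{a_1+t,\,a_2+t}=U(a_1)H_{a_1a_2}\overline{U(a_2)}$ for all $a_1,a_2\in A$; it has equivalent action on $A$ and $B$ if this holds via some $t$. $H$ has *finite local complexity* (flc) if for every $L>0$ there are finitely many $x_1,\dots,x_s\in\mathbb R^n$ such that for every $y\in\mathbb R^n$, $H$ has equivalent action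 on $\Gamma\cap B_L(x_j)$ and $\Gamma\cap B_L(y)$ for some $j$. **The flc pseudospectral problem.** The instances are the pairs $(H,\varepsilon)$, where $H$ is a short-range flc discrete operator in dimension $n$, not necessarily normal, and $\varepsilon>0$. The solution is the pseudospectrum $\mathrm{Spec}_\varepsilon(H)=\{z\in\mathbb C:\rho_H(z)\le\varepsilon\}$, where $\rho_H(z)=\|(H-z)^{-1}\|^{-1}$ for $z\notin\mathrm{Spec}(H)$ and $\rho_H(z)=0$ for $z\in\mathrm{Spec}(H)$. It is a point of the metric space $\mathcal M$ of nonempty compact subsets of $\mathbb C$ with the Hausdorff distance $d_{\mathrm H}$. An algorithm has access to $(H,\varepsilon)$ through a countable family $\Lambda$ of real evaluation functions. For each $H$ and each integer $L\ge1$ one fixes finitely many sites $x_{L,1},\dots,x_{L,N(L)}\in\Gamma$ such that for every $y\in\Gamma$ there is exactly one $m$ for which $H$ has equivalent action on $\Gamma\cap B_L(x_{L,m})$ and $\Gamma\cap B_L(y)$ via $t=y-x_{L,m}$, and for each $m$ an enumeration of the finite set $\Gamma\cap B_L(x_{L,m})$ that begins with $x_{L,m}$. The evaluation functions return: the number $N(L)$;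 the number of points of $\Gamma\cap B_L(x_{L,m})$; the real and the imaginary part of $H_{pq}$ for the $k$-th point $p$ and the $l$-th point $q$ of that set; the $i$-th coordinate of its $k$-th point; a bound on $\|H\|$; numbers $C$ and $\eta>0$ as in the short-range condition; and $\varepsilon$. They return $0$ if an index is out of range. Let $f_0,f_1,\dots$ be a standard enumeration of $\Lambda$. **BSS algorithms.** A *BSS algorithm* is a sequence of functions $c_j:\mathbb R^j\to\bigcup_l\mathbb R^l$ $(j\ge0)$, each computed by a Blum–Shub–Smale machine over $\mathbb R$ that halts on every input. On an instance it starts with the empty list of answers; given the answers $b\in\mathbb R^j$ received so far, either $c_j(b)=(a_0,i)$ with $a_0\ne0$ and $i\in\mathbb N$, and then the value of $f_i$ at the instance is appended to the list, or $c_j(b)=(0,v_1,\dots,v_{2r})$, and then the algorithm terminates with the result $\{v_1+\mathrm iv_2,\dots,v_{2r-1}+\mathrm iv_{2r}\}$ (with $\{0\}$ if $r=0$). **Theorem.** For every such family $\Lambda$ and every $k\in\mathbb N$ there is a BSS algorithm $\Gamma_k$ using $\Lambda$ that terminates on every instance and satisfies $$d_{\mathrm H}\big(\Gamma_k(H,\varepsilon),\mathrm{Spec}_\varepsilon(H)\big)\le2^{-k}\qquad\text{for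 all instances }(H,\varepsilon).$$ -/

import Mathlib

open Set Filter Topology TopologicalSpace

universe u

noncomputable section

/-! ### Blum-Shub-Smale machines over the reals -/

namespace BSS

/-- Instructions of a Blum-Shub-Smale machine. The tape is a two-sided sequence of cells, each
holding a real number; the integers in an instruction are offsets relative to the head. -/
inductive Instr : Type
  /-- write the real constant `r` to cell `i` -/
  | const (i : ℤ) (r : ℝ)
  /-- `cell i := cell j + cell k` -/
  | add (i j k : ℤ)
  /-- `cell i := cell j - cell k` -/
  | sub (i j k : ℤ)
  /-- `cell i := cell j * cell k` -/
  | mul (i j k : ℤ)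
  /-- `cell i := cell j / cell k` (with value `0` for a zero denominator) -/
  | div (i j k : ℤ)
  /-- move the head one cell to the right -/
  | right
  /-- move the head one cell to the left -/
  | left
  /-- go to line `l` of the program if `0 ≤ cell i`, else to the next line -/
  | branch (i : ℤ) (l : ℕ)

/-- A machine is given by its finite program; its states are the line numbers. -/
abbrev Program : Type := List Instr

/-- A configuration: the current line, and the tape with the head at position `0`. -/
structure Config : Type where
  line : ℕ
  tape : ℤ → ℝ

/-- The effect of one instruction. -/
def Instr.exec : Instr → Config → Config
  | .const i r, c => ⟨c.line + 1, Function.update c.tape i r⟩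
  | .add i j k, c => ⟨c.line + 1, Function.update c.tape i (c.tape j + c.tape k)⟩
  | .sub i j k, c => ⟨c.line + 1, Function.update c.tape i (c.tape j - c.tape k)⟩
  | .mul i j k, c => ⟨c.line + 1, Function.update c.tape i (c.tape j * c.tape k)⟩
  | .div i j k, c => ⟨c.line + 1, Function.update c.tape i (c.tape j / c.tape k)⟩
  | .right, c => ⟨c.line + 1, fun i => c.tape (i + 1)⟩
  | .left, c => ⟨c.line + 1, fun i => c.tape (i - 1)⟩
  | .branch i l, c => ⟨open scoped Classical in if 0 ≤ c.tape i then l else c.line + 1, c.tape⟩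

/-- One step of a machine; `none` if the current line lies outside the program, in which case the
machine has halted. -/
def Program.step (P : Program) (c : Config) : Option Config :=
  P[c.line]?.map fun I => I.exec c

/-- A finite sequence is written on the tape by putting its length at the head and its entries in
the cells to the right of it; all other cells are zero. -/
def encode (x : List ℝ) : ℤ → ℝ := fun i =>
  if i = 0 then (x.length : ℝ) else if 0 < i then x.getD (i.toNat - 1) 0 else 0

/-- The tape holds the finite sequence `y` at the head (the other cells are arbitrary). -/
def Holds (t : ℤ → ℝ) (y : List ℝ) : Prop :=
  t 0 = (y.length : ℝ) ∧ ∀ i : ℕ, i < y.length → t ((i : ℤ) + 1) = y.getD i 0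

/-- Started on the input `x`, the machine halts with output `y`. -/
def Program.HaltsWith (P : Program) (x y : List ℝ) : Prop :=
  ∃ c : Config, Relation.ReflTransGen (fun a b => P.step a = some b) ⟨0, encode x⟩ c ∧
    P.step c = none ∧ Holds c.tape y

/-- A function from `ℝ ^ k` to finite real sequences is a (total) BSS function if some machine
halts on every input from `ℝ ^ k` with the value of the function as its output. -/
def IsBSSFunction {k : ℕ} (f : (Fin k → ℝ) → List ℝ) : Prop :=
  ∃ P : Program, ∀ x : Fin k → ℝ, P.HaltsWith (List.ofFn x) (f x)

end BSS

/-! ### Computational problems and BSS algorithms -/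

/-- A computational problem with set of problems `Ω` and metric space `M` of possible solutions:
a countable family of real evaluation functions, together with an enumeration of its index set,
and the problem function `Ξ`. -/
structure ComputationalProblem (Ω : Type*) (M : Type*) [MetricSpace M] where
  /-- index set of the evaluation functions -/
  Index : Type
  /-- the evaluation functions -/
  eval : Index → Ω → ℝ
  /-- an enumeration of the index set -/
  enum : ℕ → Index
  enum_surjective : Function.Surjective enum
  /-- the exact solution -/
  Ξ : Ω → M

/-- A parametrization of a dense part of the solution space by finite real sequences. -/
structure Parametrization (M : Type*) [MetricSpace M] where
  toFun : List ℝ → M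
  dense : DenseRange toFun

/-- A BSS algorithm: a sequence of everywhere halting BSS functions `c k : ℝ ^ k → ℝ ^ ∞`, where
`c k` looks at the answers to the first `k` evaluation requests. A value `[a₀, i]` with `a₀ ≠ 0`
requests the `i`-th evaluation function; a value `0 :: v` terminates the algorithm with the
(even number of) output parameters `v`. -/
structure BSSAlgorithm where
  c : (k : ℕ) → (Fin k → ℝ) → List ℝ
  isBSSFunction : ∀ k, BSS.IsBSSFunction (c k)
  valid : ∀ k x, (∃ (a₀ : ℝ) (i : ℕ), a₀ ≠ 0 ∧ c k x = [a₀, (i : ℝ)]) ∨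
    (∃ v : List ℝ, Even v.length ∧ c k x = 0 :: v)

namespace BSSAlgorithm

variable {Ω : Type*} {M : Type*} [MetricSpace M]

/-- The state after `k` rounds on the problem instance `A`: the answers collected so far, or, once
the algorithm has terminated, its result. -/
def state (Γ : BSSAlgorithm) (P : ComputationalProblem Ω M) (F : Parametrization M) (A : Ω) :
    (k : ℕ) → (Fin k → ℝ) ⊕ M
  | 0 => .inl Fin.elim0
  | k + 1 =>
    match state Γ P F A k with
    | .inr m => .inr m
    | .inl b => open scoped Classical in
        if (Γ.c k b).getD 0 0 = 0 then .inr (F.toFun (Γ.c k b).tail)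
        else .inl (Fin.snoc b (P.eval (P.enum ⌊(Γ.c k b).getD 1 0⌋₊) A))

/-- The algorithm terminates on every problem instance, and `g` is the map `Ω → M` of its
results. -/
def Computes (Γ : BSSAlgorithm) (P : ComputationalProblem Ω M) (F : Parametrization M)
    (g : Ω → M) : Prop :=
  ∀ A : Ω, ∃ k : ℕ, Γ.state P F A k = .inr (g A)

end BSSAlgorithm

/-! ### Discrete operators of finite local complexity

`Fin n → ℝ` carries the maximum distance, and `Metric.ball x L` is the open cube of side length
`2 * L` centred at `x`. -/

/-- Distinct points have a distance larger than some fixed `q > 0`. -/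
def UniformlyDiscrete {n : ℕ} (S : Set (Fin n → ℝ)) : Prop :=
  ∃ q : ℝ, 0 < q ∧ ∀ x ∈ S, ∀ y ∈ S, x ≠ y → q < dist x y

/-- A discrete operator in dimension `n`: a bounded operator on a (nonzero) Hilbert space with an
orthonormal basis indexed by a uniformly discrete subset of `ℝ ^ n`. -/
structure DiscreteOperator (n : ℕ) where
  /-- the set of sites -/
  sites : Set (Fin n → ℝ)
  sites_nonempty : sites.Nonempty
  uniformlyDiscrete : UniformlyDiscrete sites
  /-- the Hilbert space -/
  space : Type u
  [instNormed : NormedAddCommGroup space]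
  [instInner : InnerProductSpace ℂ space]
  [instComplete : CompleteSpace space]
  /-- the orthonormal basis -/
  basis : HilbertBasis sites ℂ space
  /-- the operator -/
  op : space →L[ℂ] space

attribute [instance] DiscreteOperator.instNormed DiscreteOperator.instInner
  DiscreteOperator.instComplete

namespace DiscreteOperator

variable {n : ℕ} (H : DiscreteOperator.{u} n)

/-- The matrix element `⟨e_x, H e_y⟩`, set to zero if `x` or `y` is not a site. -/
def entry (x y : Fin n → ℝ) : ℂ :=
  open scoped Classical in
  if h : x ∈ H.sites ∧ y ∈ H.sites then
    inner ℂ (H.basis ⟨x, h.1⟩) (H.op (H.basis ⟨y, h.2⟩)) else 0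

/-- `|H_xy| ≤ C d(x,y)^(-(n+ε))` for all sites `x ≠ y` (nothing is required for `x = y`, where the
right-hand side is infinite). -/
def DecayBound (C ε : ℝ) : Prop :=
  ∀ x ∈ H.sites, ∀ y ∈ H.sites, x ≠ y → ‖H.entry x y‖ ≤ C * dist x y ^ (-((n : ℝ) + ε))

/-- `H` is short-range. -/
def IsShortRange : Prop := ∃ C ε : ℝ, 0 < ε ∧ H.DecayBound C ε

/-- The set of sites in the open cube of side length `2 * L` centred at `x`. -/
def patch (L : ℝ) (x : Fin n → ℝ) : Set (Fin n → ℝ) := H.sites ∩ Metric.ball x L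

/-- `B = t + A`, and `H` acts on `A` and `B` in the same way up to this translation and complex
phases `U`. -/
def EquivalentActionVia (t : Fin n → ℝ) (A B : Set (Fin n → ℝ)) : Prop :=
  B = (fun a => a + t) '' A ∧ ∃ U : (Fin n → ℝ) → ℂ, (∀ a ∈ A, ‖U a‖ = 1) ∧
    ∀ a₁ ∈ A, ∀ a₂ ∈ A,
      H.entry (a₁ + t) (a₂ + t) = U a₁ * H.entry a₁ a₂ * (starRingEnd ℂ) (U a₂)

/-- `H` has equivalent action on `A` and `B`. -/
def EquivalentAction (A B : Set (Fin n → ℝ)) : Prop :=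
  ∃ t : Fin n → ℝ, H.EquivalentActionVia t A B

/-- Finite local complexity: for each `L > 0` the patches `patch L y`, for arbitrary
`y ∈ ℝ ^ n`, fall into finitely many classes with respect to equivalent action. -/
def IsFLC : Prop :=
  ∀ L : ℝ, 0 < L → ∃ s : Finset (Fin n → ℝ), ∀ y : Fin n → ℝ, ∃ x ∈ s,
    H.EquivalentAction (H.patch L x) (H.patch L y)

/-- The patches of size `L` around `x` and `y` are equivalent as patches with a centre: `H` has
equivalent action on them with respect to the translation that takes `x` to `y`. -/
def EquivalentPatches (L : ℝ) (x y : Fin n → ℝ) : Prop :=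
  H.EquivalentActionVia (y - x) (H.patch L x) (H.patch L y)

/-- The choices on which the evaluation functions of `H` depend: for every positive integer scale
(written `L + 1` with `L : ℕ`) an enumeration of the patches centred at sites up to equivalence,
for every enumerated patch an enumeration of its sites that begins with the centre, a bound on the
norm, and constants for the short-range condition. -/
structure LocalData where
  numPatches : ℕ → ℕ
  center : (L : ℕ) → Fin (numPatches L) → Fin n → ℝ
  center_mem : ∀ L m, center L m ∈ H.sites
  existsUnique_patch : ∀ L : ℕ, ∀ y ∈ H.sites, ∃! m, H.EquivalentPatches (L + 1) (center L m) y
  numPoints : (L : ℕ) → Fin (numPatches L) → ℕ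
  point : (L : ℕ) → (m : Fin (numPatches L)) →
    Fin (numPoints L m) ≃ H.patch (L + 1) (center L m)
  point_zero : ∀ L m (h : 0 < numPoints L m), (point L m ⟨0, h⟩ : Fin n → ℝ) = center L m
  normBound : ℝ
  norm_le : ‖H.op‖ ≤ normBound
  decayConst : ℝ
  decayExp : ℝ
  decayExp_pos : 0 < decayExp
  decayBound : H.DecayBound decayConst decayExp

/-- The `k`-th point of the `m`-th patch at scale `L + 1` (counting from zero), if there is one. -/
def LocalData.point? {H : DiscreteOperator.{u} n} (D : H.LocalData) (L m k : ℕ) :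
    Option (Fin n → ℝ) :=
  if hm : m < D.numPatches L then
    if hk : k < D.numPoints L ⟨m, hm⟩ then some (D.point L ⟨m, hm⟩ ⟨k, hk⟩) else none
  else none

end DiscreteOperator

/-! ### Evaluation functions -/

/-- Indices of the evaluation functions of the pseudospectral problem. -/
inductive EvalIndex : Type
  | numPatches (L : ℕ)
  | numPoints (L m : ℕ)
  | entryRe (L m k l : ℕ)
  | entryIm (L m k l : ℕ)
  | coord (L m k i : ℕ)
  | normBound
  | decayConst
  | decayExp
  | level

/-- An enumeration of the indices through the Cantor-type pairing `ℕ × ℕ ≃ ℕ`. -/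
def EvalIndex.ofNat (j : ℕ) : EvalIndex :=
  let p := j.unpair
  let q := p.2.unpair
  match p.1 with
  | 0 => .numPatches p.2
  | 1 => .numPoints q.1 q.2
  | 2 => .entryRe q.1.unpair.1 q.1.unpair.2 q.2.unpair.1 q.2.unpair.2
  | 3 => .entryIm q.1.unpair.1 q.1.unpair.2 q.2.unpair.1 q.2.unpair.2
  | 4 => .coord q.1.unpair.1 q.1.unpair.2 q.2.unpair.1 q.2.unpair.2
  | 5 => .normBound
  | 6 => .decayConst
  | 7 => .decayExp
  | _ => .level

theorem EvalIndex.ofNat_surjective : Function.Surjective EvalIndex.ofNat := by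
  intro a
  cases a with
  | numPatches L => exact ⟨Nat.pair 0 L, by simp [ofNat]⟩
  | numPoints L m => exact ⟨Nat.pair 1 (Nat.pair L m), by simp [ofNat]⟩
  | entryRe L m k l =>
    exact ⟨Nat.pair 2 (Nat.pair (Nat.pair L m) (Nat.pair k l)), by simp [ofNat]⟩
  | entryIm L m k l =>
    exact ⟨Nat.pair 3 (Nat.pair (Nat.pair L m) (Nat.pair k l)), by simp [ofNat]⟩
  | coord L m k i =>
    exact ⟨Nat.pair 4 (Nat.pair (Nat.pair L m) (Nat.pair k i)), by simp [ofNat]⟩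
  | normBound => exact ⟨Nat.pair 5 0, by simp [ofNat]⟩
  | decayConst => exact ⟨Nat.pair 6 0, by simp [ofNat]⟩
  | decayExp => exact ⟨Nat.pair 7 0, by simp [ofNat]⟩
  | level => exact ⟨Nat.pair 8 0, by simp [ofNat]⟩

/-- The values of the evaluation functions at `(H, ε)`; they are zero if an index is out of
bounds. -/
def DiscreteOperator.LocalData.eval {n : ℕ} {H : DiscreteOperator.{u} n} (D : H.LocalData)
    (ε : ℝ) : EvalIndex → ℝ
  | .numPatches L => D.numPatches L
  | .numPoints L m => if h : m < D.numPatches L then D.numPoints L ⟨m, h⟩ else 0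
  | .entryRe L m k l =>
    match D.point? L m k, D.point? L m l with
    | some p, some q => (H.entry p q).re
    | _, _ => 0
  | .entryIm L m k l =>
    match D.point? L m k, D.point? L m l with
    | some p, some q => (H.entry p q).im
    | _, _ => 0
  | .coord L m k i =>
    match D.point? L m k with
    | some p => if h : i < n then p ⟨i, h⟩ else 0
    | none => 0
  | .normBound => D.normBound
  | .decayConst => D.decayConst
  | .decayExp => D.decayExp
  | .level => ε

/-! ### The pseudospectrum -/

section Pseudospectrum

variable {E : Type*} [NormedAddCommGroup E] [InnerProductSpace ℂ E]

/-- The lower norm function: `‖(z - a)⁻¹‖⁻¹` off the spectrum of `a`, and `0` on it. -/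
def lowerNorm (a : E →L[ℂ] E) (z : ℂ) : ℝ :=
  open scoped Classical in
  if z ∈ spectrum ℂ a then 0 else ‖resolvent a z‖⁻¹

/-- The closed `ε`-pseudospectrum. -/
def pseudospectrum (a : E →L[ℂ] E) (ε : ℝ) : Set ℂ := {z | lowerNorm a z ≤ ε}

theorem mem_pseudospectrum_compl {a : E →L[ℂ] E} {ε : ℝ} (hε : 0 < ε) {z : ℂ} :
    z ∈ (pseudospectrum a ε)ᶜ ↔ z ∈ resolventSet ℂ a ∧ ε < ‖resolvent a z‖⁻¹ := by
  by_cases h : z ∈ spectrum ℂ a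
  · have h' : z ∉ resolventSet ℂ a := h
    simp [pseudospectrum, lowerNorm, h, h', hε.le]
  · have h' : z ∈ resolventSet ℂ a := by simpa [spectrum] using h
    simp [pseudospectrum, lowerNorm, h, h']

theorem pseudospectrum_isCompact [CompleteSpace E] [Nontrivial E] (a : E →L[ℂ] E) {ε : ℝ} (hε : 0 < ε) :
    IsCompact (pseudospectrum a ε) := by
  have hpos : ∀ z ∈ resolventSet ℂ a, 0 < ‖resolvent a z‖ := by
    intro z hz
    exact norm_pos_iff.2 (spectrum.isUnit_resolvent.1 hz).ne_zero
  refine Metric.isCompact_of_isClosed_isBounded ?_ ?_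
  · rw [← isOpen_compl_iff, isOpen_iff_mem_nhds]
    intro z hz
    rw [mem_pseudospectrum_compl hε] at hz
    have hc : ContinuousAt (resolvent a) z :=
      (spectrum.hasDerivAt_resolvent_const_left hz.1).continuousAt
    have hc' : ContinuousAt (fun w => ‖resolvent a w‖⁻¹) z :=
      hc.norm.inv₀ (hpos z hz.1).ne'
    filter_upwards [(spectrum.isOpen_resolventSet a).mem_nhds hz.1,
      hc'.eventually (lt_mem_nhds hz.2)] with w hw₁ hw₂
    exact (mem_pseudospectrum_compl hε).2 ⟨hw₁, hw₂⟩
  · rw [← Bornology.isCobounded_compl_iff]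
    have h₁ : ∀ᶠ z in Bornology.cobounded ℂ, z ∈ resolventSet ℂ a := by
      have h := Bornology.isCobounded_compl_iff.2 (spectrum.isBounded (𝕜 := ℂ) a)
      filter_upwards [h] with z hz
      simpa [spectrum] using hz
    have h₂ : ∀ᶠ z in Bornology.cobounded ℂ, ‖resolvent a z‖ < ε⁻¹ := by
      have := (spectrum.resolvent_tendsto_cobounded (𝕜 := ℂ) a).norm
      rw [norm_zero] at this
      exact this.eventually (gt_mem_nhds (inv_pos.2 hε))
    filter_upwards [h₁, h₂] with z hz₁ hz₂
    refine (mem_pseudospectrum_compl hε).2 ⟨hz₁, ?_⟩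
    exact (lt_inv_comm₀ (hpos z hz₁) hε).1 hz₂

theorem pseudospectrum_nonempty [CompleteSpace E] [Nontrivial E] (a : E →L[ℂ] E) {ε : ℝ} (hε : 0 < ε) :
    (pseudospectrum a ε).Nonempty := by
  obtain ⟨z, hz⟩ := spectrum.nonempty a
  exact ⟨z, by simp [pseudospectrum, lowerNorm, hz, hε.le]⟩

end Pseudospectrum

theorem DiscreteOperator.nontrivial_space {n : ℕ} (H : DiscreteOperator.{u} n) :
    Nontrivial H.space := by
  obtain ⟨x, hx⟩ := H.sites_nonempty
  exact ⟨H.basis ⟨x, hx⟩, 0, H.basis.orthonormal.ne_zero _⟩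

/-! ### The computational problem -/

/-- The finite set of the complex numbers `a + i b`, for the successive pairs `a, b` of a list. -/
def pointsOfList : List ℝ → Finset ℂ
  | a :: b :: l => open scoped Classical in insert ⟨a, b⟩ (pointsOfList l)
  | _ => ∅

theorem exists_pointsOfList (s : Finset ℂ) : ∃ l, pointsOfList l = s := by
  classical
  induction s using Finset.induction_on with
  | empty => exact ⟨[], rfl⟩
  | insert z s _ ih =>
    obtain ⟨l, rfl⟩ := ih
    refine ⟨z.re :: z.im :: l, ?_⟩
    simp only [pointsOfList]

/-- The finite sets of complex numbers, as points of the space of nonempty compact subsets of `ℂ`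
with the Hausdorff distance (a list without any pair stands for `{0}`). -/
def finiteSets : Parametrization (NonemptyCompacts ℂ) where
  toFun l := open scoped Classical in
    if h : ((pointsOfList l : Finset ℂ) : Set ℂ).Nonempty then
      ⟨⟨pointsOfList l, (pointsOfList l).finite_toSet.isCompact⟩, h⟩
    else {0}
  dense := by
    refine NonemptyCompacts.dense_setOfPred_finite.mono ?_
    intro K hK
    obtain ⟨l, hl⟩ := exists_pointsOfList (Set.Finite.toFinset hK)
    refine ⟨l, ?_⟩
    have hl' : (pointsOfList l : Set ℂ) = K := by simp [hl]
    have hne : ((pointsOfList l : Finset ℂ) : Set ℂ).Nonempty := by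
      rw [hl']; exact K.nonempty
    exact (dif_pos hne).trans (SetLike.coe_injective hl')

/-- The problem instances: short-range discrete operators in dimension `n` with finite local
complexity, together with a level `ε > 0`. -/
structure PseudospectralInstance (n : ℕ) where
  H : DiscreteOperator.{u} n
  flc : H.IsFLC
  shortRange : H.IsShortRange
  ε : ℝ
  ε_pos : 0 < ε

/-- The pseudospectral problem for short-range operators of finite local complexity in dimension
`n`. The family `Λ` fixes, for each operator, the choices on which the evaluation functions
depend. -/
def flcPseudospectralProblem (n : ℕ)
    (Λ : ∀ H : DiscreteOperator.{u} n, H.IsFLC → H.IsShortRange → H.LocalData) :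
    ComputationalProblem (PseudospectralInstance.{u} n) (NonemptyCompacts ℂ) where
  Index := EvalIndex
  eval i A := (Λ A.H A.flc A.shortRange).eval A.ε i
  enum := EvalIndex.ofNat
  enum_surjective := EvalIndex.ofNat_surjective
  Ξ A :=
    haveI := A.H.nontrivial_space
    ⟨⟨pseudospectrum A.H.op A.ε, pseudospectrum_isCompact A.H.op A.ε_pos⟩,
      pseudospectrum_nonempty A.H.op A.ε_pos⟩

end

/-!
The pseudospectrum is `{z | ρ z ≤ ε}` with the lower norm function `ρ = lowerNorm H`, and `ρ z` is
the largest common lower bound of `z - H` and of its adjoint (`le_lowerNorm_iff`). Two facts make it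
computable.

*Localization.* Up to an error that tends to zero with growing scale, a lower bound for `z - H` can
be checked on vectors supported in cubes of side `R`: these cubes cover the
space with constant multiplicity, and the sum of the squared commutators of their indicator
functions with a short-range matrix is controlled by a Schur test
(`IsShortRangeMatrix.le_norm_of_forall_cube`); the part of `H ψ` outside a larger patch is small for
the same reason (`IsShortRangeMatrix.norm_le_ellTwo_add`). By finite
local complexity, only finitely many patches occur up to translations and phases, which do not
change singular values. So `ρ z` is determined, with a known error, by the smallest singular values
of finitely many finite rectangular matrices, and approximate matrix elements suffice
(`DiscreteOperator.LocalData.Approximates.le_lowerNorm` and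
`DiscreteOperator.LocalData.Approximates.patchBound`).

*Error control.* An approximation of `ρ` alone locates the pseudospectrum between its versions at
slightly smaller and slightly larger levels. These are close to each other because on a Hilbert
space `ρ` has no local minimum off the spectrum (`exists_lowerNorm_lt`, `exists_inner_net`).

The algorithm requests all evaluation functions in turn and enumerates certificates. A certificate
consists of rational approximations of finitely many answers and of finitely many points, and its
validity is a condition on singular values of finite matrices built from these rational data: the
points belong to the pseudospectrum, and what is not close to them does not. The algorithm stops
when it finds a valid certificate whose approximations fit the answers received so far. At each
stage only finitely many certificates are compared with the answers, so each stage is a finite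
decision tree, which a Blum-Shub-Smale machine carries out
(`BSS.IsDecisionTree.isBSSFunction`). A valid certificate is correct for every instance that fits it
(`Certificate.IsValid.points_spec`), and every instance fits some valid certificate
(`Certificate.exists_isValid`).
-/

noncomputable section

/-! ### Decision trees are computed by Blum-Shub-Smale machines -/

namespace BSS

/-- Functions `ℝ ^ j → ℝ ^ ∞` given by a finite decision tree whose inner nodes compare an entry
of the argument with a constant. -/
inductive IsDecisionTree {j : ℕ} : ((Fin j → ℝ) → List ℝ) → Prop
  | const (l : List ℝ) : IsDecisionTree fun _ => l
  | ite (i : Fin j) (r : ℝ) {f g : (Fin j → ℝ) → List ℝ} :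
      IsDecisionTree f → IsDecisionTree g →
      IsDecisionTree fun x => open scoped Classical in if r ≤ x i then f x else g x

/-- The machine `P` can pass from the configuration `a` to the configuration `b`. -/
abbrev Program.Reaches (P : Program) (a b : Config) : Prop :=
  Relation.ReflTransGen (fun a b => P.step a = some b) a b

theorem Program.step_append {pre post : Program} {I : Instr} {o : ℕ} (ho : pre.length = o)
    (t : ℤ → ℝ) : Program.step (pre ++ I :: post) ⟨o, t⟩ = some (I.exec ⟨o, t⟩) := by
  simp [Program.step, ← ho]

/-- The instructions that write the list `l` to the cells from `i` on. -/
def writeList (i : ℤ) : List ℝ → Program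
  | [] => []
  | r :: l => .const i r :: writeList (i + 1) l

@[simp] theorem length_writeList (l : List ℝ) : ∀ i, (writeList i l).length = l.length := by
  induction l with
  | nil => simp [writeList]
  | cons r l ih => simp [writeList, ih]

theorem reaches_writeList (l : List ℝ) (pre post : Program) (i : ℤ) (o : ℕ)
    (ho : pre.length = o) (t : ℤ → ℝ) :
    ∃ t', Program.Reaches (pre ++ writeList i l ++ post) ⟨o, t⟩ ⟨o + l.length, t'⟩ ∧
      (∀ k < i, t' k = t k) ∧ ∀ k : ℕ, k < l.length → t' (i + k) = l.getD k 0 := by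
  induction l generalizing pre i o t with
  | nil => exact ⟨t, by simp [Relation.ReflTransGen.refl], by simp, by simp⟩
  | cons r l ih =>
    obtain ⟨t', h₁, h₂, h₃⟩ := ih (pre ++ [.const i r]) (i + 1) (o + 1) (by simp [ho])
      (Function.update t i r)
    refine ⟨t', ?_, fun k hk => ?_, fun k hk => ?_⟩
    · refine Relation.ReflTransGen.head (b := ⟨o + 1, Function.update t i r⟩) ?_ ?_
      · simp only [writeList, List.append_assoc, List.cons_append]
        rw [Program.step_append ho]
        rfl
      · have : o + (r :: l).length = o + 1 + l.length := by simp; omega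
        rw [this]
        simpa [writeList] using h₁
    · rw [h₂ k (by omega), Function.update_of_ne (by omega)]
    · cases k with
      | zero => simp [h₂ i (by omega)]
      | succ k =>
        have := h₃ k (by simpa using hk)
        push_cast
        rw [show i + ((k : ℤ) + 1) = i + 1 + k by ring, this]
        simp

/-- A decision tree is realized, at every place of a program, by a piece of code that leaves the
program through a jump to a prescribed line `T`. The length `N` of the code is fixed before `T`, so
that `T` may be chosen outside the program. -/
theorem IsDecisionTree.exists_code {j : ℕ} {f : (Fin j → ℝ) → List ℝ} (hf : IsDecisionTree f) :
    ∃ N : ℕ, ∀ T o : ℕ, ∃ Q : Program, Q.length = N ∧ ∀ pre post : Program, pre.length = o →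
      ∀ (x : Fin j → ℝ) (t : ℤ → ℝ), (∀ i : Fin j, t ((i : ℤ) + 1) = x i) →
      ∃ t', Program.Reaches (pre ++ Q ++ post) ⟨o, t⟩ ⟨T, t'⟩ ∧ Holds t' (f x) := by
  induction hf with
  | const l =>
    refine ⟨l.length + 3, fun T o => ⟨writeList 0 ((l.length : ℝ) :: l) ++
      [.const (-1) 0, .branch (-1) T], by simp, fun pre post ho x t ht => ?_⟩⟩
    obtain ⟨t', h₁, -, h₃⟩ := reaches_writeList ((l.length : ℝ) :: l) pre
      ([.const (-1) 0, .branch (-1) T] ++ post) 0 o ho t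
    refine ⟨Function.update t' (-1) 0, ?_, ?_, fun i hi => ?_⟩
    · have e₁ : pre ++ (writeList 0 ((l.length : ℝ) :: l) ++ [.const (-1) 0, .branch (-1) T]) ++ post
          = pre ++ writeList 0 ((l.length : ℝ) :: l) ++
            ([.const (-1) 0, .branch (-1) T] ++ post) := by simp
      rw [e₁]
      refine h₁.trans ?_
      refine Relation.ReflTransGen.head
        (b := ⟨o + ((l.length : ℝ) :: l).length + 1, Function.update t' (-1) 0⟩) ?_
        (Relation.ReflTransGen.single ?_)
      · exact Program.step_append (by simp [ho]) _
      · rw [show ∀ p : Program, p ++ ([.const (-1) 0, .branch (-1) T] ++ post) =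
            (p ++ [.const (-1) 0]) ++ .branch (-1) T :: post by simp,
          Program.step_append (by simp [ho]; omega)]
        simp [Instr.exec]
    · have := h₃ 0 (by simp)
      simpa using this
    · have := h₃ (i + 1) (by simpa using hi)
      rw [Function.update_of_ne (by omega)]
      simpa using this
  | ite i r _ _ ihf ihg =>
    obtain ⟨Ng, ihg⟩ := ihg
    obtain ⟨Nf, ihf⟩ := ihf
    refine ⟨3 + Ng + Nf, fun T o => ?_⟩
    obtain ⟨Qg, hNg, hg⟩ := ihg T (o + 3)
    obtain ⟨Qf, hNf, hf⟩ := ihf T (o + 3 + Qg.length)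
    let head : Program := [.const (-1) r, .sub (-1) ((i : ℤ) + 1) (-1),
      .branch (-1) (o + 3 + Qg.length)]
    refine ⟨head ++ Qg ++ Qf, by simp [head, hNg, hNf]; omega, fun pre post ho x t ht => ?_⟩
    set t₁ := Function.update t (-1) r
    set t₂ := Function.update t₁ (-1) (t₁ ((i : ℤ) + 1) - t₁ (-1))
    have ht₂ : ∀ k : Fin j, t₂ ((k : ℤ) + 1) = x k := fun k => by
      simp only [t₂, t₁]
      rw [Function.update_of_ne (by omega), Function.update_of_ne (by omega), ht]
    have hval : t₂ (-1) = x i - r := by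
      simp only [t₂, t₁, Function.update_self]
      rw [Function.update_of_ne (by omega), ht]
    have hhead : ∀ R : Program, Program.Reaches (pre ++ head ++ R) ⟨o, t⟩
        ⟨open scoped Classical in if r ≤ x i then o + 3 + Qg.length else o + 3, t₂⟩ := by
      intro R
      refine Relation.ReflTransGen.head (b := ⟨o + 1, t₁⟩) ?_ (Relation.ReflTransGen.head
        (b := ⟨o + 2, t₂⟩) ?_ (Relation.ReflTransGen.single ?_))
      · simp only [head, List.append_assoc, List.cons_append]
        exact Program.step_append ho t
      · have := Program.step_append (pre := pre ++ [.const (-1) r])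
          (I := .sub (-1) ((i : ℤ) + 1) (-1)) (post := .branch (-1) (o + 3 + Qg.length) :: R)
          (o := o + 1) (by simp [ho]) t₁
        simp only [head, List.append_assoc, List.cons_append, List.nil_append] at this ⊢
        exact this
      · have := Program.step_append
          (pre := pre ++ [.const (-1) r, .sub (-1) ((i : ℤ) + 1) (-1)])
          (I := .branch (-1) (o + 3 + Qg.length)) (post := R) (o := o + 2) (by simp [ho]) t₂
        simpa [head, Instr.exec, hval] using this
    by_cases h : r ≤ x i
    · obtain ⟨t', h₁, h₂⟩ := hf (pre ++ head ++ Qg) post (by simp [ho, head]; omega) x t₂ ht₂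
      refine ⟨t', ?_, by simpa [h] using h₂⟩
      have := hhead (Qg ++ Qf ++ post)
      simp only [h, if_true, List.append_assoc] at this h₁ ⊢
      exact this.trans h₁
    · obtain ⟨t', h₁, h₂⟩ := hg (pre ++ head) (Qf ++ post) (by simp [ho, head]) x t₂ ht₂
      refine ⟨t', ?_, by simpa [h] using h₂⟩
      have := hhead (Qg ++ Qf ++ post)
      simp only [h, if_false, List.append_assoc] at this h₁ ⊢
      exact this.trans h₁

theorem encode_ofFn_succ {j : ℕ} (x : Fin j → ℝ) (i : Fin j) :
    encode (List.ofFn x) ((i : ℤ) + 1) = x i := by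
  have h₁ : (i : ℤ) + 1 ≠ 0 := by omega
  have h₂ : (0 : ℤ) < (i : ℤ) + 1 := by omega
  simp [encode, h₁, h₂]

theorem IsDecisionTree.isBSSFunction {j : ℕ} {f : (Fin j → ℝ) → List ℝ}
    (hf : IsDecisionTree f) : IsBSSFunction f := by
  obtain ⟨N, hN⟩ := hf.exists_code
  obtain ⟨Q, hQ, h⟩ := hN N 0
  refine ⟨Q, fun x => ?_⟩
  obtain ⟨t', h₁, h₂⟩ := h [] [] rfl x (encode (List.ofFn x)) (encode_ofFn_succ x)
  refine ⟨⟨N, t'⟩, by simpa using h₁, ?_, h₂⟩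
  simp [Program.step, hQ]

/-- A conjunction of finitely many two-sided bounds on the entries can be tested by a decision
tree. -/
theorem IsDecisionTree.ite_forall_mem {j : ℕ} {f g : (Fin j → ℝ) → List ℝ}
    (hf : IsDecisionTree f) (hg : IsDecisionTree g) (T : List (Fin j × ℝ × ℝ)) :
    IsDecisionTree fun x => open scoped Classical in
      if ∀ p ∈ T, p.2.1 ≤ x p.1 ∧ x p.1 < p.2.2 then f x else g x := by
  induction T with
  | nil => simpa using hf
  | cons p T ih =>
    refine (congrArg IsDecisionTree (funext fun x => ?_)).mp
      (IsDecisionTree.ite p.1 p.2.1 (IsDecisionTree.ite p.1 p.2.2 hg ih) hg)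
    by_cases h₁ : p.2.1 ≤ x p.1
    · by_cases h₂ : p.2.2 ≤ x p.1
      · have : ¬ x p.1 < p.2.2 := not_lt.2 h₂
        simp [h₁, h₂, this]
      · have h₃ : x p.1 < p.2.2 := not_le.1 h₂
        simp only [h₁, if_true, h₂, if_false, List.forall_mem_cons, h₃, true_and]
    · simp [h₁]

end BSS

/-! ### Algorithms that search for a certificate -/

/-- The sequence `a` of answers lies in the box `B`, a list of half-open intervals
`[B[i].1, B[i].2)` for its first entries. -/
def InBox (B : List (ℝ × ℝ)) (a : ℕ → ℝ) : Prop :=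
  ∀ (i : ℕ) (h : i < B.length), B[i].1 ≤ a i ∧ a i < B[i].2

section Search

variable {κ : Type*} [Encodable κ] (box : κ → List (ℝ × ℝ)) (out : κ → List ℝ)

open scoped Classical in
/-- The reaction to the first `j` answers `b`: try the certificates with codes below the bound,
accept one if `b` lies in its box, and otherwise request the evaluation function with number
`j`. -/
def search (j : ℕ) : ℕ → (Fin j → ℝ) → List ℝ
  | 0, _ => [1, (j : ℝ)]
  | i + 1, b =>
    match (Encodable.decode i : Option κ) with
    | none => search j i b
    | some p =>
      if (box p).length ≤ j ∧ InBox (box p) (fun i => if h : i < j then b ⟨i, h⟩ else 0) then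
        0 :: out p
      else search j i b

theorem isDecisionTree_search (j i : ℕ) : BSS.IsDecisionTree (search box out j i) := by
  induction i with
  | zero => exact .const _
  | succ i ih =>
    cases hp : (Encodable.decode i : Option κ) with
    | none =>
      have : search box out j (i + 1) = search box out j i := by
        funext b; simp [search, hp]
      rwa [this]
    | some p =>
      by_cases hj : (box p).length ≤ j
      · refine (congrArg BSS.IsDecisionTree (funext fun b => ?_)).mp
          ((BSS.IsDecisionTree.const (0 :: out p)).ite_forall_mem ih
            (List.ofFn fun k : Fin (box p).length => (Fin.castLE hj k, (box p)[k])))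
        simp only [search, hp, hj, true_and, List.forall_mem_ofFn_iff]
        congr 1
        simp only [InBox, eq_iff_iff]
        refine ⟨fun h => ⟨hj, fun k hk => ?_⟩, fun h k => ?_⟩
        · simpa [lt_of_lt_of_le hk hj] using h ⟨k, hk⟩
        · have := h.2 k k.2
          rwa [dif_pos (lt_of_lt_of_le k.2 hj)] at this
      · have : search box out j (i + 1) = search box out j i := by
          funext b; simp [search, hp, hj]
        rwa [this]

theorem search_eq (j i : ℕ) (b : Fin j → ℝ) :
    search box out j i b = [1, (j : ℝ)] ∨ ∃ p, (box p).length ≤ j ∧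
      InBox (box p) (fun i => if h : i < j then b ⟨i, h⟩ else 0) ∧
      search box out j i b = 0 :: out p := by
  induction i with
  | zero => exact .inl rfl
  | succ i ih =>
    cases hp : (Encodable.decode i : Option κ) with
    | none => simpa [search, hp] using ih
    | some p =>
      simp only [search, hp]
      split_ifs with h
      · exact .inr ⟨p, h.1, h.2, rfl⟩
      · exact ih

theorem search_head_eq_zero {j i : ℕ} {b : Fin j → ℝ} {p : κ} (hp : Encodable.encode p < i)
    (hj : (box p).length ≤ j)
    (hb : InBox (box p) (fun i => if h : i < j then b ⟨i, h⟩ else 0)) :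
    (search box out j i b).getD 0 0 = 0 := by
  induction i with
  | zero => omega
  | succ i ih =>
    rcases Nat.lt_succ_iff_lt_or_eq.1 hp with h | h
    · cases hq : (Encodable.decode i : Option κ) with
      | none => simpa [search, hq] using ih h
      | some q =>
        simp only [search, hq]
        split_ifs
        · simp
        · exact ih h
    · subst h
      simp [search, hj, hb]

/-- The algorithm that requests all evaluation functions in turn and stops as soon as it finds a
certificate whose box contains the answers. -/
def searchAlgorithm (hout : ∀ p, Even (out p).length) : BSSAlgorithm where
  c j := search box out j j
  isBSSFunction j := (isDecisionTree_search box out j j).isBSSFunction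
  valid j b := by
    rcases search_eq box out j j b with h | ⟨p, -, -, h⟩
    · exact .inl ⟨1, j, one_ne_zero, h⟩
    · exact .inr ⟨out p, hout p, h⟩

theorem searchAlgorithm_computes {Ω M : Type*} [MetricSpace M] (P : ComputationalProblem Ω M)
    (F : Parametrization M) (hout : ∀ p, Even (out p).length)
    (hbox : ∀ A, ∃ p, InBox (box p) fun i => P.eval (P.enum i) A) :
    ∃ g : Ω → M, (searchAlgorithm box out hout).Computes P F g ∧
      ∀ A, ∃ p, InBox (box p) (fun i => P.eval (P.enum i) A) ∧ g A = F.toFun (out p) := by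
  set Γ := searchAlgorithm box out hout
  have hstate : ∀ A k, (Γ.state P F A k = .inl fun i : Fin k => P.eval (P.enum i) A) ∨
      ∃ p, InBox (box p) (fun i => P.eval (P.enum i) A) ∧
        Γ.state P F A k = .inr (F.toFun (out p)) := by
    intro A k
    induction k with
    | zero => exact .inl (congrArg Sum.inl (Subsingleton.elim _ _))
    | succ k ih =>
      rcases ih with h | ⟨p, hp, h⟩
      · have hrw : Γ.c k = search box out k k := rfl
        rcases search_eq box out k k (fun i : Fin k => P.eval (P.enum i) A) with h' | ⟨p, hk, hp, h'⟩
        · left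
          simp only [BSSAlgorithm.state, h, hrw, h']
          simp only [List.getD_cons_zero, one_ne_zero, if_false, List.getD_cons_succ,
            Nat.floor_natCast, Sum.inl.injEq]
          funext i
          refine Fin.lastCases ?_ (fun i => ?_) i <;> simp
        · right
          refine ⟨p, fun i hi => ?_, ?_⟩
          · simpa [lt_of_lt_of_le hi hk] using hp i hi
          · simp [BSSAlgorithm.state, h, hrw, h']
      · exact .inr ⟨p, hp, by simp [BSSAlgorithm.state, h]⟩
  have hresult : ∀ A, ∃ k p, InBox (box p) (fun i => P.eval (P.enum i) A) ∧
      Γ.state P F A k = .inr (F.toFun (out p)) := by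
    intro A
    obtain ⟨p, hp⟩ := hbox A
    set k := max (Encodable.encode p + 1) (box p).length
    rcases hstate A (k + 1) with h | h
    · exfalso
      rcases hstate A k with h' | ⟨q, -, h'⟩
      · have hz : (Γ.c k fun i : Fin k => P.eval (P.enum i) A).getD 0 0 = 0 := by
          refine search_head_eq_zero box out (p := p) (by omega) (by omega) fun i hi => ?_
          have : i < k := by omega
          simpa [this] using hp i hi
        rw [BSSAlgorithm.state] at h
        simp only [h', hz, if_true] at h
        exact absurd h (by simp)
      · rw [BSSAlgorithm.state] at h
        simp [h'] at h
    · exact ⟨k + 1, h⟩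
  choose k p h₁ h₂ using hresult
  exact ⟨fun A => F.toFun (out (p A)), fun A => ⟨k A, h₂ A⟩, fun A => ⟨p A, h₁ A, rfl⟩⟩

end Search

/-! ### The lower norm function -/

section LowerNorm

variable {E : Type*} [NormedAddCommGroup E] [InnerProductSpace ℂ E]

theorem lowerNorm_nonneg (a : E →L[ℂ] E) (z : ℂ) : 0 ≤ lowerNorm a z := by
  unfold lowerNorm
  split_ifs
  · exact le_rfl
  · positivity

variable [Nontrivial E]

theorem le_lowerNorm_of_isUnit {a : E →L[ℂ] E} {z : ℂ} {c : ℝ} (hc : 0 < c)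
    (hu : IsUnit (algebraMap ℂ (E →L[ℂ] E) z - a))
    (h : ∀ ψ, c * ‖ψ‖ ≤ ‖(algebraMap ℂ (E →L[ℂ] E) z - a) ψ‖) : c ≤ lowerNorm a z := by
  have hz : z ∉ spectrum ℂ a := by simpa [spectrum.mem_iff] using hu
  rw [lowerNorm, if_neg hz]
  have hr : IsUnit (resolvent a z) := spectrum.isUnit_resolvent.1 hu
  rw [le_inv_comm₀ hc (norm_pos_iff.2 hr.ne_zero)]
  refine ContinuousLinearMap.opNorm_le_bound _ (inv_nonneg.2 hc.le) fun ψ => ?_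
  have hmul : (algebraMap ℂ (E →L[ℂ] E) z - a) * resolvent a z = 1 :=
    Ring.mul_inverse_cancel _ hu
  have h₁ : (algebraMap ℂ (E →L[ℂ] E) z - a) (resolvent a z ψ) = ψ := DFunLike.congr_fun hmul ψ
  have := h (resolvent a z ψ)
  rw [h₁] at this
  rwa [inv_mul_eq_div, le_div_iff₀ hc, mul_comm]

variable [CompleteSpace E]

/-- The lower norm function is the largest common lower bound of `z - a` and of its adjoint. -/
theorem le_lowerNorm_iff {a : E →L[ℂ] E} {z : ℂ} {c : ℝ} (hc : 0 < c) :
    c ≤ lowerNorm a z ↔ (∀ ψ, c * ‖ψ‖ ≤ ‖(algebraMap ℂ (E →L[ℂ] E) z - a) ψ‖) ∧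
      ∀ ψ, c * ‖ψ‖ ≤ ‖ContinuousLinearMap.adjoint (algebraMap ℂ (E →L[ℂ] E) z - a) ψ‖ := by
  constructor
  · intro h
    have hz : z ∉ spectrum ℂ a := fun hz => by
      rw [lowerNorm, if_pos hz] at h; exact absurd hc (not_lt.2 h)
    have hu : IsUnit (algebraMap ℂ (E →L[ℂ] E) z - a) := by
      simpa [spectrum.mem_iff] using hz
    rw [lowerNorm, if_neg hz] at h
    set T := algebraMap ℂ (E →L[ℂ] E) z - a with hT
    set R := resolvent a z with hR
    have hTR : T * R = 1 := Ring.mul_inverse_cancel _ hu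
    have hRT : R * T = 1 := Ring.inverse_mul_cancel _ hu
    have hRc : c * ‖R‖ ≤ 1 := by
      have hpos : 0 < ‖R‖ := norm_pos_iff.2 (spectrum.isUnit_resolvent.1 hu).ne_zero
      rwa [← le_div_iff₀ hpos, one_div]
    have key : ∀ S Q : E →L[ℂ] E, Q * S = 1 → c * ‖Q‖ ≤ 1 → ∀ ψ, c * ‖ψ‖ ≤ ‖S ψ‖ := by
      intro S Q hQS hQ ψ
      have h₁ : ‖ψ‖ ≤ ‖Q‖ * ‖S ψ‖ := by
        have h₂ : Q (S ψ) = ψ := DFunLike.congr_fun hQS ψ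
        conv_lhs => rw [← h₂]
        exact Q.le_opNorm _
      calc c * ‖ψ‖ ≤ c * (‖Q‖ * ‖S ψ‖) := by gcongr
        _ = c * ‖Q‖ * ‖S ψ‖ := by ring
        _ ≤ 1 * ‖S ψ‖ := by gcongr
        _ = ‖S ψ‖ := one_mul _
    refine ⟨key T R hRT hRc, key _ (ContinuousLinearMap.adjoint R) ?_ ?_⟩
    · rw [← ContinuousLinearMap.star_eq_adjoint, ← ContinuousLinearMap.star_eq_adjoint,
        ← star_mul, hTR, star_one]
    · rwa [LinearIsometryEquiv.norm_map]
  · rintro ⟨h₁, h₂⟩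
    refine le_lowerNorm_of_isUnit hc ?_ h₁
    set T := algebraMap ℂ (E →L[ℂ] E) z - a with hT
    have hbij : Function.Bijective T := by
      rw [ContinuousLinearMap.bijective_iff_dense_range_and_antilipschitz]
      refine ⟨?_, ⟨⟨c⁻¹, inv_nonneg.2 hc.le⟩, T.antilipschitz_of_bound fun ψ => ?_⟩⟩
      · rw [Submodule.topologicalClosure_eq_top_iff, ContinuousLinearMap.orthogonal_range,
          LinearMap.ker_eq_bot']
        intro ψ hψ
        have hψ' : ContinuousLinearMap.adjoint T ψ = 0 := hψ
        have := h₂ ψ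
        rw [hψ', norm_zero] at this
        have h0 : ‖ψ‖ ≤ 0 := nonpos_of_mul_nonpos_right this hc
        exact norm_le_zero_iff.1 h0
      · change ‖ψ‖ ≤ c⁻¹ * ‖T ψ‖
        rw [inv_mul_eq_div, le_div_iff₀ hc, mul_comm]
        exact h₁ ψ
    exact ContinuousLinearMap.isUnit_iff_bijective.2 hbij

theorem lowerNorm_le_add (a : E →L[ℂ] E) (z w : ℂ) :
    lowerNorm a w ≤ lowerNorm a z + ‖w - z‖ := by
  rcases le_or_gt (lowerNorm a w - ‖w - z‖) 0 with h | h
  · have := lowerNorm_nonneg a z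
    linarith
  suffices lowerNorm a w - ‖w - z‖ ≤ lowerNorm a z by linarith
  have hw : 0 < lowerNorm a w := by have := norm_nonneg (w - z); linarith
  obtain ⟨h₁, h₂⟩ := (le_lowerNorm_iff hw).1 le_rfl
  have key : ∀ (S Q : E →L[ℂ] E), ‖S - Q‖ ≤ ‖w - z‖ →
      (∀ ψ, lowerNorm a w * ‖ψ‖ ≤ ‖S ψ‖) →
      ∀ ψ, (lowerNorm a w - ‖w - z‖) * ‖ψ‖ ≤ ‖Q ψ‖ := by
    intro S Q hSQ hS ψ
    have e₁ : ‖S ψ‖ ≤ ‖Q ψ‖ + ‖(S - Q) ψ‖ := by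
      have : S ψ = Q ψ + (S - Q) ψ := by simp
      rw [this]; exact norm_add_le _ _
    have e₂ := ((S - Q).le_opNorm ψ).trans (mul_le_mul_of_nonneg_right hSQ (norm_nonneg ψ))
    have := hS ψ
    linarith
  have hd : ‖(algebraMap ℂ (E →L[ℂ] E) w - a) - (algebraMap ℂ (E →L[ℂ] E) z - a)‖ ≤ ‖w - z‖ := by
    rw [sub_sub_sub_cancel_right, ← map_sub, norm_algebraMap']
  refine (le_lowerNorm_iff h).2 ⟨key _ _ hd h₁, key _ _ ?_ h₂⟩
  rwa [← map_sub, LinearIsometryEquiv.norm_map]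

theorem continuous_lowerNorm (a : E →L[ℂ] E) : Continuous (lowerNorm a) := by
  refine LipschitzWith.continuous (K := 1) (LipschitzWith.of_le_add fun z w => ?_)
  rw [dist_eq_norm]
  exact lowerNorm_le_add a w z

/-- On a Hilbert space the lower norm function has no local minimum off the spectrum. If it were
at least `ε = lowerNorm a z` at the four points `z ± h`, `z ± ih`, then the parallelogram identity,
applied to `(T + δ) (T - δ) χ = T² χ - δ² χ` with `T = z - a` and `δ = ± h, ± ih`, would bound
`‖T² χ‖² - ε² ‖T χ‖²` from below by a positive multiple of `‖χ‖²`, so that `T` would have a lower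
bound larger than `ε`. -/
theorem exists_lowerNorm_lt {a : E →L[ℂ] E} {z : ℂ} (hz : 0 < lowerNorm a z) {r : ℝ}
    (hr : 0 < r) : ∃ w, ‖w - z‖ ≤ r ∧ lowerNorm a w < lowerNorm a z := by
  by_contra! hcon
  set ε := lowerNorm a z with hε
  set T := algebraMap ℂ (E →L[ℂ] E) z - a with hT
  -- The bound `h < ε` makes the gain `ε ^ 2 * h ^ 2 - h ^ 4` positive.
  set h : ℝ := min r (ε / 2) with hh
  have hh0 : 0 < h := lt_min hr (by linarith)
  have hhr : h ≤ r := min_le_left _ _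
  have hhε : h ≤ ε / 2 := min_le_right _ _
  have hbound : ∀ δ : ℂ, ‖δ‖ = h → ∀ φ, ε * ‖φ‖ ≤ ‖T φ + δ • φ‖ := by
    intro δ hδ φ
    have h₁ := hcon (z + δ) (by simpa [hδ] using hhr)
    have h₂ := ((le_lowerNorm_iff hz).1 h₁).1 φ
    have h₃ : (algebraMap ℂ (E →L[ℂ] E) (z + δ) - a) φ = T φ + δ • φ := by
      simp [hT, Algebra.algebraMap_eq_smul_one, add_smul]
      abel
    rwa [h₃] at h₂
  have hstep : ∀ δ : ℂ, ‖δ‖ = h → ∀ χ,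
      ε ^ 2 * ‖T χ - δ • χ‖ ^ 2 ≤ ‖T (T χ) - (δ ^ 2) • χ‖ ^ 2 := by
    intro δ hδ χ
    have h₁ := hbound δ hδ (T χ - δ • χ)
    have h₂ : T (T χ - δ • χ) + δ • (T χ - δ • χ) = T (T χ) - (δ ^ 2) • χ := by
      rw [map_sub, map_smul, smul_sub, smul_smul, pow_two]; abel
    rw [h₂] at h₁
    rw [← mul_pow]
    gcongr
  have hsum : ∀ χ, ε ^ 2 * (‖T χ‖ ^ 2 + h ^ 2 * ‖χ‖ ^ 2) ≤ ‖T (T χ)‖ ^ 2 + h ^ 4 * ‖χ‖ ^ 2 := by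
    intro χ
    have e₁ := hstep (h : ℂ) (by simp [abs_of_pos hh0]) χ
    have e₂ := hstep (-(h : ℂ)) (by simp [abs_of_pos hh0]) χ
    have e₃ := hstep (Complex.I * h) (by simp [abs_of_pos hh0]) χ
    have e₄ := hstep (-(Complex.I * h)) (by simp [abs_of_pos hh0]) χ
    have p₁ := parallelogram_law_with_norm ℂ (T χ) ((h : ℂ) • χ)
    have p₂ := parallelogram_law_with_norm ℂ (T χ) ((Complex.I * h) • χ)
    have p₃ := parallelogram_law_with_norm ℂ (T (T χ)) (((h : ℂ) ^ 2) • χ)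
    have n₁ : ‖(h : ℂ) • χ‖ = h * ‖χ‖ := by rw [norm_smul]; simp [abs_of_pos hh0]
    have n₂ : ‖(Complex.I * h) • χ‖ = h * ‖χ‖ := by rw [norm_smul]; simp [abs_of_pos hh0]
    have n₃ : ‖((h : ℂ) ^ 2) • χ‖ = h ^ 2 * ‖χ‖ := by rw [norm_smul]; simp
    rw [n₁] at p₁
    rw [n₂] at p₂
    rw [n₃] at p₃
    rw [neg_smul, sub_neg_eq_add, neg_sq] at e₂ e₄
    rw [mul_pow, Complex.I_sq, neg_one_mul, neg_smul, sub_neg_eq_add] at e₃ e₄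
    nlinarith [e₁, e₂, e₃, e₄, p₁, p₂, p₃]
  have hu : IsUnit T := by
    by_contra hu
    have : z ∈ spectrum ℂ a := hu
    rw [hε, lowerNorm, if_pos this] at hz
    exact lt_irrefl _ hz
  set N := ‖T‖ with hN
  have hN0 : 0 < N := norm_pos_iff.2 hu.ne_zero
  set κ := (ε ^ 2 * h ^ 2 - h ^ 4) / N ^ 2 with hκ
  have hκ0 : 0 < κ := by
    have : 0 < h ^ 2 * (ε ^ 2 - h ^ 2) := mul_pos (by positivity) (by nlinarith)
    exact div_pos (by nlinarith) (by positivity)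
  have hlow : ∀ ψ, √(ε ^ 2 + κ) * ‖ψ‖ ≤ ‖T ψ‖ := by
    intro ψ
    obtain ⟨χ, rfl⟩ := (ContinuousLinearMap.isUnit_iff_bijective.1 hu).2 ψ
    have h₁ := hsum χ
    have h₂ : ‖T χ‖ ^ 2 ≤ N ^ 2 * ‖χ‖ ^ 2 := by
      rw [← mul_pow]; gcongr; exact T.le_opNorm χ
    have h₃ : κ * ‖T χ‖ ^ 2 ≤ (ε ^ 2 * h ^ 2 - h ^ 4) * ‖χ‖ ^ 2 := by
      calc κ * ‖T χ‖ ^ 2 ≤ κ * (N ^ 2 * ‖χ‖ ^ 2) := by gcongr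
        _ = _ := by rw [hκ]; field_simp
    refine le_of_sq_le_sq ?_ (norm_nonneg _)
    rw [mul_pow, Real.sq_sqrt (by positivity)]
    nlinarith
  have hle := le_lowerNorm_of_isUnit (Real.sqrt_pos.2 (by positivity)) hu hlow
  have : ε < √(ε ^ 2 + κ) := Real.lt_sqrt_of_sq_lt (by linarith)
  exact absurd hle (not_le.2 this)

/-- The complex number with the given rational real and imaginary parts. -/
def ratPoint (q : ℚ × ℚ) : ℂ := ⟨q.1, q.2⟩

theorem denseRange_ratPoint : DenseRange ratPoint := by
  have h : DenseRange (Prod.map ((↑) : ℚ → ℝ) ((↑) : ℚ → ℝ)) :=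
    Rat.denseRange_cast.prodMap Rat.denseRange_cast
  have := (Complex.equivRealProdCLM.symm.surjective.denseRange).comp h
    Complex.equivRealProdCLM.symm.continuous
  convert this using 1
  funext q
  apply Complex.ext <;> simp [ratPoint]

/-- The pseudospectrum is approximated from inside by finitely many rational points at a slightly
smaller level, which are still close to all points of slightly larger level. -/
theorem exists_inner_net (a : E →L[ℂ] E) {ε : ℝ} (hε : 0 < ε) {r : ℝ} (hr : 0 < r) :
    ∃ β > 0, ∃ v : Finset (ℚ × ℚ), (∀ q ∈ v, lowerNorm a (ratPoint q) < ε - β) ∧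
      ∀ z, lowerNorm a z ≤ ε + β → ∃ q ∈ v, dist z (ratPoint q) ≤ r := by
  have hc := continuous_lowerNorm a
  have hcover : pseudospectrum a ε ⊆
      ⋃ q : {q : ℚ × ℚ // lowerNorm a (ratPoint q) < ε}, Metric.ball (ratPoint q) r := by
    intro z hz
    obtain ⟨w, hwz, hw⟩ : ∃ w, ‖w - z‖ ≤ r / 2 ∧ lowerNorm a w < ε := by
      rcases lt_or_eq_of_le (show lowerNorm a z ≤ ε from hz) with h | h
      · exact ⟨z, by simp; linarith, h⟩
      · obtain ⟨w, h₁, h₂⟩ := exists_lowerNorm_lt (by rw [h]; exact hε) (half_pos hr)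
        exact ⟨w, h₁, h ▸ h₂⟩
    obtain ⟨q, hq₁, hq₂⟩ := denseRange_ratPoint.exists_mem_open
      ((isOpen_lt hc continuous_const).inter Metric.isOpen_ball)
      ⟨w, hw, Metric.mem_ball_self (half_pos hr)⟩
    refine mem_iUnion.2 ⟨⟨q, hq₁⟩, ?_⟩
    rw [Metric.mem_ball] at hq₂ ⊢
    have := dist_triangle z w (ratPoint q)
    rw [dist_comm z w, dist_eq_norm w z, dist_comm w] at this
    linarith
  obtain ⟨t, ht⟩ := (pseudospectrum_isCompact a hε).elim_finite_subcover _
    (fun _ => Metric.isOpen_ball) hcover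
  set U := ⋃ q ∈ t, Metric.ball (ratPoint q) r with hU
  have hUo : IsOpen U := isOpen_biUnion fun _ _ => Metric.isOpen_ball
  have h₁ : ∀ᶠ β in 𝓝[>] (0 : ℝ), ∀ q ∈ t, lowerNorm a (ratPoint q) < ε - β := by
    rw [Filter.eventually_all_finset]
    intro q _
    have : Tendsto (fun β : ℝ => ε - β) (𝓝[>] 0) (𝓝 ε) := by
      have : Tendsto (fun β : ℝ => ε - β) (𝓝 0) (𝓝 (ε - 0)) := tendsto_const_nhds.sub tendsto_id
      rw [sub_zero] at this
      exact this.mono_left nhdsWithin_le_nhds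
    exact this.eventually (lt_mem_nhds q.2)
  have h₂ : ∀ᶠ β in 𝓝[>] (0 : ℝ), ∀ z, lowerNorm a z ≤ ε + β → z ∈ U := by
    have hK : IsCompact (pseudospectrum a (ε + 1) \ U) :=
      (pseudospectrum_isCompact a (by linarith)).diff hUo
    rcases (pseudospectrum a (ε + 1) \ U).eq_empty_or_nonempty with he | hne
    · filter_upwards [Ioo_mem_nhdsGT (show (0 : ℝ) < 1 by norm_num)] with β hβ z hz
      by_contra hzU
      have : z ∈ pseudospectrum a (ε + 1) \ U := ⟨hz.trans (by linarith [hβ.2]), hzU⟩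
      rw [he] at this
      exact this
    · obtain ⟨z₀, hz₀, hmin⟩ := hK.exists_isMinOn hne hc.continuousOn
      have hlt : ε < lowerNorm a z₀ := by
        by_contra hle
        exact hz₀.2 (ht (not_lt.1 hle))
      filter_upwards [Ioo_mem_nhdsGT (show (0 : ℝ) < min 1 (lowerNorm a z₀ - ε) from
        lt_min one_pos (by linarith))] with β hβ z hz
      have hβ1 := hβ.2.trans_le (min_le_left _ _)
      have hβ2 := hβ.2.trans_le (min_le_right _ _)
      by_contra hzU
      have : lowerNorm a z₀ ≤ lowerNorm a z :=
        hmin (show z ∈ pseudospectrum a (ε + 1) \ U from ⟨hz.trans (by linarith), hzU⟩)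
      linarith
  obtain ⟨β, ⟨hβ₁, hβ₂⟩, hβ⟩ := ((h₁.and h₂).and self_mem_nhdsWithin).exists
  classical
  refine ⟨β, hβ, t.image (↑), ?_, fun z hz => ?_⟩
  · simp only [Finset.mem_image]
    rintro _ ⟨q, hq, rfl⟩
    exact hβ₁ q hq
  · obtain ⟨q, hq, hzq⟩ := mem_iUnion₂.1 (hβ₂ z hz)
    exact ⟨q, Finset.mem_image_of_mem _ hq, (Metric.mem_ball.1 hzq).le⟩

end LowerNorm

/-! ### Lattice sums -/

section LatticeSums

/-- The profile `max 1 (|u| - 1) ^ (-(n + 1 / (q + 1)))`, for `u ∈ ℤ ^ n` and the maximum norm. It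
dominates the matrix elements of a short-range operator between sites in unit cells that differ by
`u`; as two such sites have distance at least `|u| - 1`, it is constant near the diagonal. -/
def decayProfile (n q : ℕ) (u : Fin n → ℤ) : ℝ :=
  max 1 (‖u‖ - 1) ^ (-((n : ℝ) + 1 / ((q : ℝ) + 1)))

variable {n : ℕ}

theorem decayProfile_nonneg (q : ℕ) (u : Fin n → ℤ) : 0 ≤ decayProfile n q u :=
  Real.rpow_nonneg (le_max_of_le_left zero_le_one) _

theorem decayProfile_neg (q : ℕ) (u : Fin n → ℤ) :
    decayProfile n q (-u) = decayProfile n q u := by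
  simp [decayProfile]

theorem summable_norm_rpow_pi_int {s : ℝ} (hs : s < -(n : ℝ)) :
    Summable fun u : Fin n → ℤ => ‖u‖ ^ s := by
  let L : Submodule ℤ (Fin n → ℝ) := Submodule.span ℤ (Set.range (Pi.basisFun ℝ (Fin n)))
  have hL : Module.finrank ℤ L = n := by
    rw [ZLattice.rank ℝ L]; simp
  have hsum := ZLattice.summable_norm_rpow L s (by rw [hL]; exact hs)
  let f : (Fin n → ℤ) → L := fun u => ⟨fun i => (u i : ℝ), by
    rw [Module.Basis.mem_span_iff_repr_mem]
    intro i
    exact ⟨u i, by simp⟩⟩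
  have hf : Function.Injective f := by
    intro u v huv
    funext i
    have : ((u i : ℤ) : ℝ) = v i := congrFun (congrArg Subtype.val huv) i
    exact_mod_cast this
  refine (hsum.comp_injective hf).congr fun u => ?_
  have : ‖f u‖ = ‖u‖ := by
    change ‖fun i => ((u i : ℤ) : ℝ)‖ = ‖u‖
    simp [Pi.norm_def, nnnorm, Int.norm_eq_abs]
  simp [Function.comp, this]

theorem summable_decayProfile (n q : ℕ) : Summable (decayProfile n q) := by
  set s : ℝ := (n : ℝ) + 1 / ((q : ℝ) + 1) with hs
  have hs0 : 0 < s := by positivity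
  have hlt : -s < -(n : ℝ) := by rw [hs]; have : (0 : ℝ) < 1 / ((q : ℝ) + 1) := by positivity
                                 linarith
  refine Summable.of_norm_bounded_eventually
    ((summable_norm_rpow_pi_int hlt).mul_left ((1 / 2) ^ (-s))) ?_
  refine (Set.finite_singleton (0 : Fin n → ℤ)).subset fun u hu => ?_
  by_contra hu0
  refine hu ?_
  have h1 : 1 ≤ ‖u‖ := by
    obtain ⟨i, hi⟩ := Function.ne_iff.1 (show u ≠ 0 from hu0)
    refine le_trans ?_ (norm_le_pi_norm u i)
    rw [Int.norm_eq_abs]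
    exact_mod_cast Int.one_le_abs hi
  change ‖decayProfile n q u‖ ≤ (1 / 2) ^ (-s) * ‖u‖ ^ (-s)
  rw [Real.norm_of_nonneg (decayProfile_nonneg q u), decayProfile,
    ← Real.mul_rpow (by norm_num) (norm_nonneg _)]
  refine Real.rpow_le_rpow_of_nonpos (by positivity) ?_ (by linarith)
  rcases le_total 2 ‖u‖ with h | h
  · exact le_max_of_le_right (by linarith)
  · exact le_max_of_le_left (by linarith)

/-- The bound of the Schur test for a matrix dominated by `M` times the decay profile, on sites of
which each unit cell holds at most `K`, and weighted with `w`. -/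
def schurBound (n q K M : ℕ) (w : (Fin n → ℤ) → ℝ) : ℝ :=
  K * M * √((∑' u, decayProfile n q u) * ∑' u, decayProfile n q u * w u)

theorem schurBound_nonneg (q K M : ℕ) (w : (Fin n → ℤ) → ℝ) : 0 ≤ schurBound n q K M w := by
  unfold schurBound; positivity

theorem summable_decayProfile_mul (q : ℕ) {w : (Fin n → ℤ) → ℝ} {C : ℝ} (h0 : ∀ u, 0 ≤ w u)
    (hC : ∀ u, w u ≤ C) : Summable fun u => decayProfile n q u * w u :=
  Summable.of_nonneg_of_le (fun u => mul_nonneg (decayProfile_nonneg q u) (h0 u))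
    (fun u => mul_le_mul_of_nonneg_left (hC u) (decayProfile_nonneg q u))
    ((summable_decayProfile n q).mul_right C)

theorem tendsto_schurBound (q K M : ℕ) {w : ℕ → (Fin n → ℤ) → ℝ} {C : ℝ} (h0 : ∀ j u, 0 ≤ w j u)
    (hC : ∀ j u, w j u ≤ C) (hw : ∀ u, Tendsto (fun j => w j u) atTop (𝓝 0)) :
    Tendsto (fun j => schurBound n q K M (w j)) atTop (𝓝 0) := by
  have h₁ : Tendsto (fun j => ∑' u, decayProfile n q u * w j u) atTop
      (𝓝 (∑' u : Fin n → ℤ, (0 : ℝ))) := by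
    refine tendsto_tsum_of_dominated_convergence ((summable_decayProfile n q).mul_right C)
      (fun u => by simpa using (hw u).const_mul (decayProfile n q u))
      (.of_forall fun j u => ?_)
    rw [Real.norm_of_nonneg (mul_nonneg (decayProfile_nonneg q u) (h0 j u))]
    exact mul_le_mul_of_nonneg_left (hC j u) (decayProfile_nonneg q u)
  rw [tsum_zero] at h₁
  have h₂ := ((h₁.const_mul (∑' u, decayProfile n q u)).sqrt).const_mul ((K : ℝ) * M)
  simpa [schurBound] using h₂

/-- The weight of the commutators with the indicator functions of cubes of side `R`. -/
def cubeWeight (n R : ℕ) (u : Fin n → ℤ) : ℝ := 2 * min 1 (n * ‖u‖ / R)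

/-- The weight of the part of a matrix at distance at least `r` from the diagonal. -/
def tailWeight (r : ℝ) (u : Fin n → ℤ) : ℝ := open scoped Classical in if r ≤ ‖u‖ then 1 else 0

theorem cubeWeight_nonneg (R : ℕ) (u : Fin n → ℤ) : 0 ≤ cubeWeight n R u := by
  unfold cubeWeight; positivity

theorem cubeWeight_le (R : ℕ) (u : Fin n → ℤ) : cubeWeight n R u ≤ 2 := by
  unfold cubeWeight
  linarith [min_le_left 1 (n * ‖u‖ / R)]

theorem tailWeight_nonneg (r : ℝ) (u : Fin n → ℤ) : 0 ≤ tailWeight r u := by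
  unfold tailWeight; split_ifs <;> simp

theorem tailWeight_le (r : ℝ) (u : Fin n → ℤ) : tailWeight r u ≤ 1 := by
  unfold tailWeight; split_ifs <;> simp

theorem tendsto_schurBound_cubeWeight (n q K M : ℕ) :
    Tendsto (fun R => schurBound n q K M (cubeWeight n R)) atTop (𝓝 0) := by
  refine tendsto_schurBound q K M cubeWeight_nonneg cubeWeight_le fun u => ?_
  have h₁ : Tendsto (fun R : ℕ => n * ‖u‖ / (R : ℝ)) atTop (𝓝 0) :=
    tendsto_const_div_atTop_nhds_zero_nat _
  have h₂ := ((tendsto_const_nhds (x := (1 : ℝ))).min h₁).const_mul 2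
  simpa [cubeWeight] using h₂

theorem tendsto_schurBound_tailWeight (n q K M : ℕ) (s : ℝ) :
    Tendsto (fun L : ℕ => schurBound n q K M (tailWeight (L - s))) atTop (𝓝 0) := by
  refine tendsto_schurBound q K M (fun _ => tailWeight_nonneg _) (fun _ => tailWeight_le _)
    fun u => tendsto_const_nhds.congr' ?_
  filter_upwards [tendsto_natCast_atTop_atTop.eventually_gt_atTop (‖u‖ + s)] with L hL
  rw [tailWeight, if_neg (by linarith)]

/-- The corners of the cubes of side `R` that contain the cell `u`. -/
def cubesContaining (R : ℕ) (u : Fin n → ℤ) : Finset (Fin n → ℤ) :=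
  Fintype.piFinset fun i => Finset.Ioc (u i - R) (u i)

theorem mem_cubesContaining {R : ℕ} {u c : Fin n → ℤ} :
    c ∈ cubesContaining R u ↔ ∀ i, u i - R < c i ∧ c i ≤ u i := by
  simp [cubesContaining]

theorem card_cubesContaining (R : ℕ) (u : Fin n → ℤ) : (cubesContaining R u).card = R ^ n := by
  simp [cubesContaining]

theorem card_cubesContaining_sdiff_le {R : ℕ} (hR : 0 < R) (u v : Fin n → ℤ) :
    ((cubesContaining R u \ cubesContaining R v).card : ℝ) ≤
      (R : ℝ) ^ n * min 1 (n * ‖u - v‖ / R) := by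
  have hR' : (0 : ℝ) < R := by exact_mod_cast hR
  have h₁ : ((cubesContaining R u \ cubesContaining R v).card : ℝ) ≤ (R : ℝ) ^ n := by
    have := Finset.card_le_card (Finset.sdiff_subset (s := cubesContaining R u)
      (t := cubesContaining R v))
    rw [card_cubesContaining] at this
    exact_mod_cast this
  rw [mul_min_of_nonneg _ _ (by positivity), mul_one]
  refine le_min h₁ ?_
  rcases le_or_gt (R : ℝ) ‖u - v‖ with h | h
  · refine h₁.trans (le_mul_of_one_le_right (by positivity) ?_)
    have hn : 1 ≤ n := by
      rcases Nat.eq_zero_or_pos n with rfl | hn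
      · rw [Subsingleton.elim (u - v) 0, norm_zero] at h
        linarith
      · exact hn
    rw [le_div_iff₀ hR', one_mul]
    have hn' : (1 : ℝ) ≤ n := by exact_mod_cast hn
    nlinarith [norm_nonneg (u - v)]
  · have hinter : (R : ℝ) ^ n * (1 - n * (‖u - v‖ / R)) ≤
        ((cubesContaining R u ∩ cubesContaining R v).card : ℝ) := by
      have hcard : ((cubesContaining R u ∩ cubesContaining R v).card : ℝ) =
          ∏ i, ((Finset.Ioc (u i - R) (u i) ∩ Finset.Ioc (v i - R) (v i)).card : ℝ) := by
        rw [cubesContaining, cubesContaining, ← Fintype.piFinset_inter, Fintype.card_piFinset]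
        push_cast; rfl
      have hb := one_add_mul_le_pow (a := -(‖u - v‖ / R)) (by
        have : ‖u - v‖ / R ≤ 1 := (div_le_one hR').2 h.le
        linarith) n
      calc (R : ℝ) ^ n * (1 - n * (‖u - v‖ / R))
          ≤ (R : ℝ) ^ n * (1 + -(‖u - v‖ / R)) ^ n := by
            gcongr; linarith
        _ = ∏ _i : Fin n, ((R : ℝ) - ‖u - v‖) := by
            rw [← mul_pow, Finset.prod_const, Finset.card_univ, Fintype.card_fin]
            congr 1
            field_simp
            ring
        _ ≤ _ := by
            rw [hcard]
            refine Finset.prod_le_prod (fun i _ => by linarith) fun i _ => ?_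
            have hi := norm_le_pi_norm (u - v) i
            rw [Pi.sub_apply, Int.norm_eq_abs] at hi
            rw [Finset.Ioc_inter_Ioc, Int.card_Ioc]
            have hz : (R : ℤ) - |u i - v i| ≤
                (((u i ⊓ v i) - ((u i - R) ⊔ (v i - R))).toNat : ℤ) := by
              refine le_trans ?_ (Int.self_le_toNat _)
              grind
            have hz' : (R : ℝ) - |((u i : ℝ) - v i)| ≤
                (((u i ⊓ v i) - ((u i - R) ⊔ (v i - R))).toNat : ℝ) := by exact_mod_cast hz
            push_cast at hi
            linarith
    have hadd : ((cubesContaining R u \ cubesContaining R v).card : ℝ) +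
        ((cubesContaining R u ∩ cubesContaining R v).card : ℝ) = (R : ℝ) ^ n := by
      have := Finset.card_sdiff_add_card_inter (cubesContaining R u) (cubesContaining R v)
      rw [card_cubesContaining] at this
      exact_mod_cast this
    have : (R : ℝ) ^ n * (n * ‖u - v‖ / R) = (R : ℝ) ^ n * (n * (‖u - v‖ / R)) := by ring
    linarith

/-- The indicator function of the cube of side `R` with corner `c`. -/
def cubeIndicator (R : ℕ) (c u : Fin n → ℤ) : ℂ := if c ∈ cubesContaining R u then 1 else 0

theorem sum_norm_cubeIndicator_sub_le {R : ℕ} (hR : 0 < R) (I : Finset (Fin n → ℤ))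
    (u v : Fin n → ℤ) :
    ∑ c ∈ I, ‖cubeIndicator R c u - cubeIndicator R c v‖ ≤ (R : ℝ) ^ n * cubeWeight n R (v - u) := by
  have h : ∀ c, ‖cubeIndicator R c u - cubeIndicator R c v‖ =
      (if c ∈ cubesContaining R u \ cubesContaining R v then (1 : ℝ) else 0) +
        (if c ∈ cubesContaining R v \ cubesContaining R u then (1 : ℝ) else 0) := by
    intro c
    by_cases h₁ : c ∈ cubesContaining R u <;> by_cases h₂ : c ∈ cubesContaining R v <;>
      simp [cubeIndicator, h₁, h₂]
  simp_rw [h, Finset.sum_add_distrib, Finset.sum_boole]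
  have hle : ∀ S : Finset (Fin n → ℤ), ((I.filter (· ∈ S)).card : ℝ) ≤ S.card := fun S => by
    exact_mod_cast Finset.card_le_card fun c hc => (Finset.mem_filter.1 hc).2
  have h₁ := (hle _).trans (card_cubesContaining_sdiff_le hR u v)
  have h₂ := (hle _).trans (card_cubesContaining_sdiff_le hR v u)
  rw [norm_sub_rev u v] at h₁
  unfold cubeWeight
  linarith

end LatticeSums

/-! ### Finite `ℓ²` norms -/

section EllTwo

variable {ι : Type*}

/-- The `ℓ²` norm of the restriction of `f` to the finite set `s`. -/
def ellTwo (s : Finset ι) (f : ι → ℂ) : ℝ := √(∑ x ∈ s, ‖f x‖ ^ 2)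

theorem ellTwo_nonneg (s : Finset ι) (f : ι → ℂ) : 0 ≤ ellTwo s f := Real.sqrt_nonneg _

theorem ellTwo_sq (s : Finset ι) (f : ι → ℂ) : ellTwo s f ^ 2 = ∑ x ∈ s, ‖f x‖ ^ 2 :=
  Real.sq_sqrt (by positivity)

theorem ellTwo_add_le (s : Finset ι) (f g : ι → ℂ) :
    ellTwo s (fun x => f x + g x) ≤ ellTwo s f + ellTwo s g := by
  have h : ∀ f : ι → ℂ, ellTwo s f = ‖WithLp.toLp 2 (fun x : s => f x)‖ := fun f => by
    rw [EuclideanSpace.norm_eq, ellTwo, ← Finset.sum_coe_sort]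
  rw [h, h, h]
  exact norm_add_le (WithLp.toLp 2 fun x : s => f x) (WithLp.toLp 2 fun x : s => g x)

theorem ellTwo_le {s : Finset ι} {f : ι → ℂ} {C : ℝ} (hC : 0 ≤ C)
    (h : ∑ x ∈ s, ‖f x‖ ^ 2 ≤ C ^ 2) : ellTwo s f ≤ C :=
  Real.sqrt_le_iff.2 ⟨hC, h⟩

end EllTwo

/-! ### The Schur test and localization in cubes -/

section Localization

variable {n : ℕ} {ι : Type*}

/-- The indices `x` sit in unit cells `cell x`, with at most `K` in each cell, and the off-diagonal
entries of the matrix `a` are dominated by `M` times the decay profile. -/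
structure IsShortRangeMatrix (cell : ι → Fin n → ℤ) (q K M : ℕ) (a : ι → ι → ℂ) : Prop where
  card_le : ∀ (s : Finset ι) (u : Fin n → ℤ), (∀ x ∈ s, cell x = u) → s.card ≤ K
  norm_le : ∀ x y, x ≠ y → ‖a x y‖ ≤ M * decayProfile n q (cell x - cell y)

variable {cell : ι → Fin n → ℤ} {q K M : ℕ} {a : ι → ι → ℂ}

theorem IsShortRangeMatrix.sum_le (ha : IsShortRangeMatrix cell q K M a) (s : Finset ι)
    (v : Fin n → ℤ) {f : (Fin n → ℤ) → ℝ} (h0 : ∀ u, 0 ≤ f u) (hf : Summable f) :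
    ∑ x ∈ s, f (cell x - v) ≤ K * ∑' u, f u := by
  classical
  have e : ∑' u, f (u - v) = ∑' u, f u := (Equiv.subRight v).tsum_eq f
  have hf' : Summable fun u => f (u - v) := (Equiv.subRight v).summable_iff.2 hf
  rw [Finset.sum_comp (fun u => f (u - v)) cell]
  calc ∑ u ∈ s.image cell, (s.filter fun x => cell x = u).card • f (u - v)
      ≤ ∑ u ∈ s.image cell, K * f (u - v) := by
        refine Finset.sum_le_sum fun u _ => ?_
        rw [nsmul_eq_mul]
        refine mul_le_mul_of_nonneg_right ?_ (h0 _)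
        exact_mod_cast ha.card_le _ u fun x hx => (Finset.mem_filter.1 hx).2
    _ = K * ∑ u ∈ s.image cell, f (u - v) := by rw [Finset.mul_sum]
    _ ≤ K * ∑' u, f (u - v) := by
        gcongr
        exact hf'.sum_le_tsum _ fun u _ => h0 _
    _ = _ := by rw [e]

/-- A weighted Schur test, for a family of multipliers `g c x y` that vanish on the diagonal. -/
theorem IsShortRangeMatrix.ellTwo_le (ha : IsShortRangeMatrix cell q K M a) {γ : Type*}
    (I : Finset γ) (X Y : Finset ι) (g : γ → ι → ι → ℂ) (hg1 : ∀ c x y, ‖g c x y‖ ≤ 1)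
    (hg0 : ∀ c x, g c x x = 0) {w : (Fin n → ℤ) → ℝ} {A C : ℝ} (hA : 0 ≤ A)
    (hw0 : ∀ u, 0 ≤ w u) (hwC : ∀ u, w u ≤ C)
    (hw : ∀ x ∈ X, ∀ y ∈ Y, ∑ c ∈ I, ‖g c x y‖ ≤ A * w (cell x - cell y)) (ψ : ι → ℂ) :
    ellTwo (I ×ˢ X) (fun p => ∑ y ∈ Y, a p.2 y * g p.1 p.2 y * ψ y) ≤
      √A * schurBound n q K M w * ellTwo Y ψ := by
  set S := ∑' u, decayProfile n q u with hS
  set W := ∑' u, decayProfile n q u * w u with hW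
  have hS0 : 0 ≤ S := tsum_nonneg (decayProfile_nonneg q)
  have hW0 : 0 ≤ W := tsum_nonneg fun u => mul_nonneg (decayProfile_nonneg q u) (hw0 u)
  -- The multipliers remove the diagonal, on which nothing is known.
  have hterm : ∀ c x y, ‖a x y‖ * ‖g c x y‖ ≤
      M * decayProfile n q (cell x - cell y) * ‖g c x y‖ := by
    intro c x y
    by_cases hxy : x = y
    · subst hxy; simp [hg0]
    · exact mul_le_mul_of_nonneg_right (ha.norm_le x y hxy) (norm_nonneg _)
  have hrow : ∀ c x, ∑ y ∈ Y, ‖a x y‖ * ‖g c x y‖ ≤ K * M * S := by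
    intro c x
    calc ∑ y ∈ Y, ‖a x y‖ * ‖g c x y‖
        ≤ ∑ y ∈ Y, M * decayProfile n q (cell y - cell x) := by
          refine Finset.sum_le_sum fun y _ => (hterm c x y).trans ?_
          rw [← decayProfile_neg, neg_sub]
          exact mul_le_of_le_one_right
            (mul_nonneg (Nat.cast_nonneg _) (decayProfile_nonneg q _)) (hg1 c x y)
      _ = M * ∑ y ∈ Y, decayProfile n q (cell y - cell x) := by rw [Finset.mul_sum]
      _ ≤ M * (K * S) := by
          gcongr
          exact ha.sum_le Y (cell x) (decayProfile_nonneg q) (summable_decayProfile n q)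
      _ = K * M * S := by ring
  have hcol : ∀ y ∈ Y, ∑ c ∈ I, ∑ x ∈ X, ‖a x y‖ * ‖g c x y‖ ≤ A * (K * M * W) := by
    intro y hy
    rw [Finset.sum_comm]
    calc ∑ x ∈ X, ∑ c ∈ I, ‖a x y‖ * ‖g c x y‖
        ≤ ∑ x ∈ X, M * A * (decayProfile n q (cell x - cell y) * w (cell x - cell y)) := by
          refine Finset.sum_le_sum fun x hx => ?_
          calc ∑ c ∈ I, ‖a x y‖ * ‖g c x y‖
              ≤ ∑ c ∈ I, M * decayProfile n q (cell x - cell y) * ‖g c x y‖ :=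
                Finset.sum_le_sum fun c _ => hterm c x y
            _ = M * decayProfile n q (cell x - cell y) * ∑ c ∈ I, ‖g c x y‖ := by
                rw [Finset.mul_sum]
            _ ≤ M * decayProfile n q (cell x - cell y) * (A * w (cell x - cell y)) :=
                mul_le_mul_of_nonneg_left (hw x hx y hy)
                  (mul_nonneg (Nat.cast_nonneg _) (decayProfile_nonneg q _))
            _ = _ := by ring
      _ = M * A * ∑ x ∈ X, decayProfile n q (cell x - cell y) * w (cell x - cell y) := by
          rw [Finset.mul_sum]
      _ ≤ M * A * (K * W) := by
          gcongr
          exact ha.sum_le X (cell y) (f := fun u => decayProfile n q u * w u)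
            (fun u => mul_nonneg (decayProfile_nonneg q u) (hw0 u))
            (summable_decayProfile_mul q hw0 hwC)
      _ = _ := by ring
  have hcs : ∀ c x, ‖∑ y ∈ Y, a x y * g c x y * ψ y‖ ^ 2 ≤
      K * M * S * ∑ y ∈ Y, ‖a x y‖ * ‖g c x y‖ * ‖ψ y‖ ^ 2 := by
    intro c x
    have h₁ : ‖∑ y ∈ Y, a x y * g c x y * ψ y‖ ≤ ∑ y ∈ Y, ‖a x y‖ * ‖g c x y‖ * ‖ψ y‖ :=
      (norm_sum_le _ _).trans (Finset.sum_le_sum fun y _ => by rw [norm_mul, norm_mul])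
    have h₂ := Finset.sum_sq_le_sum_mul_sum_of_sq_le_mul Y
      (r := fun y => ‖a x y‖ * ‖g c x y‖ * ‖ψ y‖) (f := fun y => ‖a x y‖ * ‖g c x y‖)
      (g := fun y => ‖a x y‖ * ‖g c x y‖ * ‖ψ y‖ ^ 2) (fun y _ => by positivity)
      (fun y _ => by positivity) (fun y _ => le_of_eq (by ring))
    calc _ ≤ (∑ y ∈ Y, ‖a x y‖ * ‖g c x y‖ * ‖ψ y‖) ^ 2 := by gcongr
      _ ≤ _ := h₂
      _ ≤ _ := mul_le_mul_of_nonneg_right (hrow c x) (by positivity)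
  refine _root_.ellTwo_le (mul_nonneg (mul_nonneg (Real.sqrt_nonneg _) (schurBound_nonneg ..))
    (ellTwo_nonneg ..)) ?_
  calc ∑ p ∈ I ×ˢ X, ‖∑ y ∈ Y, a p.2 y * g p.1 p.2 y * ψ y‖ ^ 2
      ≤ ∑ p ∈ I ×ˢ X, K * M * S * ∑ y ∈ Y, ‖a p.2 y‖ * ‖g p.1 p.2 y‖ * ‖ψ y‖ ^ 2 :=
        Finset.sum_le_sum fun p _ => hcs p.1 p.2
    _ = K * M * S * ∑ y ∈ Y, (∑ c ∈ I, ∑ x ∈ X, ‖a x y‖ * ‖g c x y‖) * ‖ψ y‖ ^ 2 := by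
        rw [← Finset.mul_sum, Finset.sum_comm]
        simp_rw [Finset.sum_product, Finset.sum_mul]
    _ ≤ K * M * S * ∑ y ∈ Y, A * (K * M * W) * ‖ψ y‖ ^ 2 := by
        gcongr with y hy
        exact hcol y hy
    _ = (√A * schurBound n q K M w * ellTwo Y ψ) ^ 2 := by
        rw [mul_pow, mul_pow, ellTwo_sq, Real.sq_sqrt hA, schurBound, mul_pow,
          Real.sq_sqrt (mul_nonneg hS0 hW0), ← Finset.mul_sum]
        ring

variable {E : Type*} [NormedAddCommGroup E] [InnerProductSpace ℂ E] (b : HilbertBasis ι ℂ E)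

theorem hasSum_norm_sq_inner (ψ : E) : HasSum (fun x => ‖inner ℂ (b x) ψ‖ ^ 2) (‖ψ‖ ^ 2) := by
  have h := (b.hasSum_inner_mul_inner ψ ψ).mapL Complex.reCLM
  convert h using 1
  · funext x
    rw [Complex.reCLM_apply, ← inner_conj_symm ψ (b x), ← Complex.normSq_eq_conj_mul_self,
      Complex.ofReal_re, Complex.normSq_eq_norm_sq]
  · rw [Complex.reCLM_apply, inner_self_eq_norm_sq_to_K]
    norm_cast

theorem ellTwo_inner_le (X : Finset ι) (ψ : E) : ellTwo X (fun x => inner ℂ (b x) ψ) ≤ ‖ψ‖ :=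
  ellTwo_le (norm_nonneg _) (sum_le_hasSum _ (fun _ _ => by positivity) (hasSum_norm_sq_inner b ψ))

/-- The vector with the coefficients `f` on the finite set `Y`. -/
def finiteVector (Y : Finset ι) (f : ι → ℂ) : E := ∑ y ∈ Y, f y • b y

theorem norm_finiteVector (Y : Finset ι) (f : ι → ℂ) : ‖finiteVector b Y f‖ = ellTwo Y f := by
  rw [ellTwo, eq_comm, Real.sqrt_eq_iff_eq_sq (by positivity) (norm_nonneg _), finiteVector]
  have h := b.orthonormal.inner_sum f f Y
  rw [inner_self_eq_norm_sq_to_K] at h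
  have h₂ : ∀ y, (starRingEnd ℂ) (f y) * f y = ((‖f y‖ ^ 2 : ℝ) : ℂ) := fun y => by
    rw [← Complex.normSq_eq_conj_mul_self, Complex.normSq_eq_norm_sq]
  simp_rw [h₂] at h
  push_cast at h
  refine Complex.ofReal_injective ?_
  push_cast
  exact h.symm

theorem inner_finiteVector (T : E →L[ℂ] E) (x : ι) (Y : Finset ι) (f : ι → ℂ) :
    inner ℂ (b x) (T (finiteVector b Y f)) = ∑ y ∈ Y, inner ℂ (b x) (T (b y)) * f y := by
  simp [finiteVector, mul_comm]

theorem le_norm_of_forall_finiteVector (T : E →L[ℂ] E) {t : ℝ}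
    (h : ∀ Y f, t * ‖finiteVector b Y f‖ ≤ ‖T (finiteVector b Y f)‖) (ψ : E) :
    t * ‖ψ‖ ≤ ‖T ψ‖ := by
  have hs : Tendsto (fun Y : Finset ι => finiteVector b Y (b.repr ψ)) atTop (𝓝 ψ) :=
    b.hasSum_repr ψ
  exact le_of_tendsto_of_tendsto' (hs.norm.const_mul t) ((T.continuous.tendsto ψ).comp hs).norm
    fun Y => h Y _

/-- Localization: a lower bound for `T` on all vectors supported in cubes of side `R` is, up to the
norm of the commutators with the indicator functions of these cubes, a lower bound for `T`. The
cubes with corners in `ℤ ^ n` cover each cell exactly `R ^ n` times, and the sum over all cubes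
of the squared commutator terms is controlled by the Schur test. -/
theorem IsShortRangeMatrix.le_norm_of_forall_cube {T : E →L[ℂ] E}
    (hT : IsShortRangeMatrix cell q K M fun x y => inner ℂ (b x) (T (b y))) {R : ℕ} (hR : 0 < R)
    {t : ℝ} (h : ∀ (Y : Finset ι) (f : ι → ℂ),
      (∀ x ∈ Y, ∀ y ∈ Y, ∀ i, |cell x i - cell y i| < R) →
        t * ‖finiteVector b Y f‖ ≤ ‖T (finiteVector b Y f)‖) (ψ : E) :
    (t - schurBound n q K M (cubeWeight n R)) * ‖ψ‖ ≤ ‖T ψ‖ := by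
  classical
  set δ := schurBound n q K M (cubeWeight n R) with hδ
  have hδ0 : 0 ≤ δ := schurBound_nonneg ..
  refine le_norm_of_forall_finiteVector b T (fun Y f => ?_) ψ
  rcases le_or_gt t 0 with ht | ht
  · exact (mul_nonpos_of_nonpos_of_nonneg (by linarith) (norm_nonneg _)).trans (norm_nonneg _)
  set φ := finiteVector b Y f with hφ
  set Q : ℝ := (R : ℝ) ^ n with hQ
  have hQ0 : 0 < Q := by positivity
  set I : Finset (Fin n → ℤ) := Y.biUnion fun y => cubesContaining R (cell y) with hI
  -- The truncation of `φ` to the cube with corner `c`.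
  let P : (Fin n → ℤ) → E := fun c => finiteVector b Y fun y => cubeIndicator R c (cell y) * f y
  have hsq : ∀ (J : Finset (Fin n → ℤ)) u, ∑ c ∈ J, ‖cubeIndicator R c u‖ ^ 2 =
      ((J ∩ cubesContaining R u).card : ℝ) := by
    intro J u
    have : ∀ c, ‖cubeIndicator R c u‖ ^ 2 = if c ∈ cubesContaining R u then (1 : ℝ) else 0 := by
      intro c; unfold cubeIndicator; split_ifs <;> simp
    simp_rw [this, Finset.sum_boole, Finset.filter_mem_eq_inter]
  have hsqle : ∀ u, ∑ c ∈ I, ‖cubeIndicator R c u‖ ^ 2 ≤ Q := by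
    intro u
    rw [hsq, hQ]
    have := Finset.card_le_card (Finset.inter_subset_right (s₁ := I) (s₂ := cubesContaining R u))
    rw [card_cubesContaining] at this
    exact_mod_cast this
  have hnormP : ∑ c ∈ I, ‖P c‖ ^ 2 = Q * ‖φ‖ ^ 2 := by
    simp_rw [P, hφ, norm_finiteVector, ellTwo_sq]
    rw [Finset.sum_comm, Finset.mul_sum]
    refine Finset.sum_congr rfl fun y hy => ?_
    simp_rw [norm_mul, mul_pow]
    rw [← Finset.sum_mul, hsq, Finset.inter_eq_right.2
      (Finset.subset_biUnion_of_mem (fun y => cubesContaining R (cell y)) hy),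
      card_cubesContaining, hQ]
    push_cast; rfl
  have hlocal : ∀ c, t * ‖P c‖ ≤ ‖T (P c)‖ := by
    intro c
    have hPc : P c = finiteVector b (Y.filter fun y => c ∈ cubesContaining R (cell y)) f := by
      simp only [P, finiteVector, Finset.sum_filter]
      refine Finset.sum_congr rfl fun y _ => ?_
      unfold cubeIndicator
      split_ifs <;> simp
    rw [hPc]
    refine h _ f fun x hx y hy i => ?_
    have h₁ := mem_cubesContaining.1 (Finset.mem_filter.1 hx).2 i
    have h₂ := mem_cubesContaining.1 (Finset.mem_filter.1 hy).2 i
    rw [abs_lt]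
    constructor <;> linarith [h₁.1, h₁.2, h₂.1, h₂.2]
  have hfinite : ∀ X : Finset ι, ∑ x ∈ X, ∑ c ∈ I, ‖inner ℂ (b x) (T (P c))‖ ^ 2 ≤
      (√Q * (‖T φ‖ + δ * ‖φ‖)) ^ 2 := by
    intro X
    have hsplit : ∀ p : (Fin n → ℤ) × ι, inner ℂ (b p.2) (T (P p.1)) =
        cubeIndicator R p.1 (cell p.2) * inner ℂ (b p.2) (T φ) +
        ∑ y ∈ Y, inner ℂ (b p.2) (T (b y)) *
          (cubeIndicator R p.1 (cell y) - cubeIndicator R p.1 (cell p.2)) * f y := by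
      rintro ⟨c, x⟩
      simp only [P, hφ, inner_finiteVector, Finset.mul_sum, ← Finset.sum_add_distrib]
      exact Finset.sum_congr rfl fun y _ => by ring
    have h₁ : ellTwo (I ×ˢ X) (fun p => cubeIndicator R p.1 (cell p.2) *
        inner ℂ (b p.2) (T φ)) ≤ √Q * ‖T φ‖ := by
      refine _root_.ellTwo_le (by positivity) ?_
      rw [mul_pow, Real.sq_sqrt hQ0.le, Finset.sum_product, Finset.sum_comm]
      simp_rw [norm_mul, mul_pow, ← Finset.sum_mul]
      calc _ ≤ ∑ x ∈ X, Q * ‖inner ℂ (b x) (T φ)‖ ^ 2 := by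
            gcongr with x _
            exact hsqle _
        _ = Q * ∑ x ∈ X, ‖inner ℂ (b x) (T φ)‖ ^ 2 := by rw [Finset.mul_sum]
        _ ≤ Q * ‖T φ‖ ^ 2 := by
            gcongr
            exact sum_le_hasSum _ (fun _ _ => by positivity) (hasSum_norm_sq_inner b _)
    have h₂ := hT.ellTwo_le I X Y
      (fun c x y => cubeIndicator R c (cell y) - cubeIndicator R c (cell x))
      (fun c x y => by
        unfold cubeIndicator; split_ifs <;> simp)
      (fun c x => sub_self _) hQ0.le (cubeWeight_nonneg R) (cubeWeight_le R)
      (fun x _ y _ => sum_norm_cubeIndicator_sub_le hR I (cell y) (cell x)) f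
    rw [← norm_finiteVector b, ← hφ, ← hδ] at h₂
    have h₃ : ellTwo (I ×ˢ X) (fun p => inner ℂ (b p.2) (T (P p.1))) ≤
        √Q * (‖T φ‖ + δ * ‖φ‖) := by
      simp_rw [hsplit]
      refine (ellTwo_add_le _ _ _).trans ?_
      linarith
    have h₄ := pow_le_pow_left₀ (ellTwo_nonneg _ _) h₃ 2
    rwa [ellTwo_sq, Finset.sum_product, Finset.sum_comm] at h₄
  have hTP : ∑ c ∈ I, ‖T (P c)‖ ^ 2 ≤ (√Q * (‖T φ‖ + δ * ‖φ‖)) ^ 2 :=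
    hasSum_le_of_sum_le (hasSum_sum fun c _ => hasSum_norm_sq_inner b (T (P c))) hfinite
  have hmain : (√Q * (t * ‖φ‖)) ^ 2 ≤ (√Q * (‖T φ‖ + δ * ‖φ‖)) ^ 2 := by
    refine le_trans ?_ hTP
    calc (√Q * (t * ‖φ‖)) ^ 2 = t ^ 2 * (Q * ‖φ‖ ^ 2) := by
          rw [mul_pow, Real.sq_sqrt hQ0.le]; ring
      _ = ∑ c ∈ I, (t * ‖P c‖) ^ 2 := by
          rw [← hnormP, Finset.mul_sum]
          exact Finset.sum_congr rfl fun c _ => by ring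
      _ ≤ _ := Finset.sum_le_sum fun c _ =>
          pow_le_pow_left₀ (by positivity) (hlocal c) 2
  have := le_of_mul_le_mul_left (le_of_sq_le_sq hmain (by positivity)) (Real.sqrt_pos.2 hQ0)
  linarith

/-- Outside a finite set `X`, the image of a vector supported in `Y` is small if all cells of
`Y` are at distance at least `r` from the cells outside `X`. -/
theorem IsShortRangeMatrix.norm_le_ellTwo_add {T : E →L[ℂ] E}
    (hT : IsShortRangeMatrix cell q K M fun x y => inner ℂ (b x) (T (b y))) (X Y : Finset ι)
    {r : ℝ} (h : ∀ x ∉ X, ∀ y ∈ Y, r ≤ ‖cell x - cell y‖) (hYX : Y ⊆ X) (f : ι → ℂ) :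
    ‖T (finiteVector b Y f)‖ ≤ ellTwo X (fun x => inner ℂ (b x) (T (finiteVector b Y f))) +
      schurBound n q K M (tailWeight r) * ‖finiteVector b Y f‖ := by
  classical
  set φ := finiteVector b Y f with hφ
  set δ := schurBound n q K M (tailWeight r) with hδ
  have hδ0 : 0 ≤ δ := schurBound_nonneg ..
  have hX0 := ellTwo_nonneg X fun x => inner ℂ (b x) (T φ)
  have htail : ∀ Z : Finset ι, ∑ x ∈ Z \ X, ‖inner ℂ (b x) (T φ)‖ ^ 2 ≤ (δ * ‖φ‖) ^ 2 := by
    intro Z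
    have h₁ := hT.ellTwo_le {()} (Z \ X) Y (fun _ x y => if x ∈ X then 0 else if x = y then 0 else 1)
      (fun _ x y => by split_ifs <;> simp) (fun _ x => by simp) zero_le_one (tailWeight_nonneg r)
      (tailWeight_le r) (fun x hx y hy => by
        rw [tailWeight, if_pos (h x (Finset.mem_sdiff.1 hx).2 y hy)]
        rw [Finset.sum_singleton]
        split_ifs <;> simp) f
    rw [Real.sqrt_one, one_mul, ← norm_finiteVector b, ← hφ, ← hδ] at h₁
    have h₂ := pow_le_pow_left₀ (ellTwo_nonneg _ _) h₁ 2
    rw [ellTwo_sq, Finset.sum_product, Finset.sum_singleton] at h₂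
    refine le_of_eq_of_le (Finset.sum_congr rfl fun x hx => ?_) h₂
    have hxX := (Finset.mem_sdiff.1 hx).2
    rw [hφ, inner_finiteVector]
    congr 2
    refine Finset.sum_congr rfl fun y hy => ?_
    have hxy : x ≠ y := fun e => hxX (hYX (e ▸ hy))
    simp [hxX, hxy]
  have hsq : ‖T φ‖ ^ 2 ≤ (ellTwo X (fun x => inner ℂ (b x) (T φ)) + δ * ‖φ‖) ^ 2 := by
    refine hasSum_le_of_sum_le (hasSum_norm_sq_inner b (T φ)) fun Z => ?_
    calc ∑ x ∈ Z, ‖inner ℂ (b x) (T φ)‖ ^ 2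
        = ∑ x ∈ Z \ X, ‖inner ℂ (b x) (T φ)‖ ^ 2 + ∑ x ∈ Z ∩ X, ‖inner ℂ (b x) (T φ)‖ ^ 2 := by
          rw [← Finset.sum_union (Finset.disjoint_sdiff_inter Z X), Finset.sdiff_union_inter]
      _ ≤ (δ * ‖φ‖) ^ 2 + ellTwo X (fun x => inner ℂ (b x) (T φ)) ^ 2 := by
          rw [ellTwo_sq]
          refine add_le_add (htail Z) (Finset.sum_le_sum_of_subset_of_nonneg
            Finset.inter_subset_right fun _ _ _ => by positivity)
      _ ≤ _ := by nlinarith [mul_nonneg hX0 (mul_nonneg hδ0 (norm_nonneg φ))]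
  exact le_of_sq_le_sq hsq (by positivity)

end Localization

/-! ### Singular value bounds for finite matrices -/

section FiniteMatrices

/-- The `N × N` matrix `B` is bounded below by `t` on the vectors supported in `I`. -/
def SingularBound (N : ℕ) (B : ℕ → ℕ → ℂ) (I : ℕ → Prop) (t : ℝ) : Prop :=
  ∀ v : ℕ → ℂ, (∀ k < N, v k ≠ 0 → I k) → t * ellTwo (Finset.range N) v ≤
    ellTwo (Finset.range N) fun k => ∑ l ∈ Finset.range N, B k l * v l

theorem SingularBound.of_nonpos (N : ℕ) (B : ℕ → ℕ → ℂ) (I : ℕ → Prop) {t : ℝ} (ht : t ≤ 0) :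
    SingularBound N B I t := fun _ _ =>
  (mul_nonpos_of_nonpos_of_nonneg ht (ellTwo_nonneg _ _)).trans (ellTwo_nonneg _ _)

theorem SingularBound.mono {N : ℕ} {A : ℕ → ℕ → ℂ} {I : ℕ → Prop} {t t' : ℝ} (htt' : t' ≤ t)
    (h : SingularBound N A I t) : SingularBound N A I t' := fun v hv =>
  (mul_le_mul_of_nonneg_right htt' (ellTwo_nonneg _ _)).trans (h v hv)

theorem SingularBound.perturb {N : ℕ} {B B' : ℕ → ℕ → ℂ} {I : ℕ → Prop} {t θ : ℝ} (hθ : 0 ≤ θ)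
    (hB : SingularBound N B I t) (h : ∀ k < N, ∀ l < N, ‖B k l - B' k l‖ ≤ θ) :
    SingularBound N B' I (t - N ^ 2 * θ) := by
  intro v hv
  set V := ellTwo (Finset.range N) v with hV
  have hV0 : 0 ≤ V := ellTwo_nonneg _ _
  have hrow : ∀ k < N, ‖∑ l ∈ Finset.range N, (B k l - B' k l) * v l‖ ≤ N * (θ * V) := by
    intro k hk
    refine (norm_sum_le _ _).trans ((Finset.sum_le_card_nsmul _ _ (θ * V) fun l hl => ?_).trans
      (by simp))
    rw [norm_mul]
    refine mul_le_mul (h k hk l (Finset.mem_range.1 hl)) ?_ (norm_nonneg _) hθ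
    refine Real.le_sqrt_of_sq_le ?_
    exact Finset.single_le_sum (f := fun x => ‖v x‖ ^ 2) (fun _ _ => by positivity) hl
  have hdiff : ellTwo (Finset.range N)
      (fun k => ∑ l ∈ Finset.range N, (B k l - B' k l) * v l) ≤ N ^ 2 * θ * V := by
    refine ellTwo_le (by positivity) ?_
    calc _ ≤ ∑ k ∈ Finset.range N, (N * (θ * V)) ^ 2 := by
          refine Finset.sum_le_sum fun k hk => ?_
          exact pow_le_pow_left₀ (norm_nonneg _) (hrow k (Finset.mem_range.1 hk)) 2
      _ = N * (N * (θ * V)) ^ 2 := by simp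
      _ ≤ N ^ 2 * (N * (θ * V)) ^ 2 := by
          gcongr
          rcases Nat.eq_zero_or_pos N with rfl | hN
          · simp
          · exact_mod_cast Nat.le_self_pow two_ne_zero N
      _ = _ := by ring
  have htri := ellTwo_add_le (Finset.range N) (fun k => ∑ l ∈ Finset.range N, B' k l * v l)
    (fun k => ∑ l ∈ Finset.range N, (B k l - B' k l) * v l)
  have he : (fun k => (∑ l ∈ Finset.range N, B' k l * v l) +
      ∑ l ∈ Finset.range N, (B k l - B' k l) * v l) =
      fun k => ∑ l ∈ Finset.range N, B k l * v l := by
    funext k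
    rw [← Finset.sum_add_distrib]
    exact Finset.sum_congr rfl fun l _ => by ring
  rw [he] at htri
  have := hB v hv
  rw [sub_mul]
  linarith

variable {ι E : Type*} [NormedAddCommGroup E] [InnerProductSpace ℂ E] (b : HilbertBasis ι ℂ E)
  (T : E →L[ℂ] E) {N : ℕ} {s : ℕ → ι} {A : ℕ → ℕ → ℂ} {I : ℕ → Prop} {t : ℝ}

/-- A singular value bound for the matrix of `T` on the sites `s 0, …, s (N - 1)`, taken up to
phases, is a lower bound for `T` on the vectors supported in `Y`. -/
theorem SingularBound.le_norm_finiteVector (hs : Set.InjOn s (Finset.range N)) {u : ℕ → ℂ}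
    (hu : ∀ k < N, ‖u k‖ = 1)
    (hA : ∀ k < N, ∀ l < N,
      inner ℂ (b (s k)) (T (b (s l))) = u k * A k l * (starRingEnd ℂ) (u l))
    (h : SingularBound N A I t) {Y : Finset ι} (hY : ∀ y ∈ Y, ∃ k < N, s k = y ∧ I k)
    (f : ι → ℂ) : t * ‖finiteVector b Y f‖ ≤ ‖T (finiteVector b Y f)‖ := by
  classical
  set g : ℕ → ℂ := fun k => if s k ∈ Y then f (s k) else 0 with hg
  have hsum : ∀ F : ι → ℂ, ∑ y ∈ Y, F y =
      ∑ k ∈ Finset.range N, if s k ∈ Y then F (s k) else 0 := by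
    intro F
    rw [← Finset.sum_image (f := fun y => if y ∈ Y then F y else 0) hs, ← Finset.sum_filter]
    refine Finset.sum_congr ?_ fun _ _ => rfl
    ext y
    simp only [Finset.mem_filter, Finset.mem_image, Finset.mem_range]
    constructor
    · intro hy
      obtain ⟨k, hk, hky, -⟩ := hY y hy
      exact ⟨⟨k, hk, hky⟩, hy⟩
    · exact fun h => h.2
  set v : ℕ → ℂ := fun k => (starRingEnd ℂ) (u k) * g k with hv
  have hnorm : ‖finiteVector b Y f‖ = ellTwo (Finset.range N) v := by
    have h₁ := hsum fun y => ((‖f y‖ ^ 2 : ℝ) : ℂ)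
    rw [norm_finiteVector, ellTwo, ellTwo]
    congr 1
    have h₂ : ∀ k ∈ Finset.range N, ((‖v k‖ ^ 2 : ℝ) : ℂ) =
        if s k ∈ Y then ((‖f (s k)‖ ^ 2 : ℝ) : ℂ) else 0 := by
      intro k hk
      simp only [hv, hg, norm_mul, RCLike.norm_conj, hu k (Finset.mem_range.1 hk), one_mul]
      split_ifs <;> simp
    rw [← Finset.sum_congr rfl h₂] at h₁
    exact_mod_cast h₁
  have hcoef : ∀ k ∈ Finset.range N, ‖inner ℂ (b (s k)) (T (finiteVector b Y f))‖ =
      ‖∑ l ∈ Finset.range N, A k l * v l‖ := by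
    intro k hk
    rw [inner_finiteVector, hsum]
    have : ∀ l ∈ Finset.range N,
        (if s l ∈ Y then inner ℂ (b (s k)) (T (b (s l))) * f (s l) else 0) =
          u k * (A k l * v l) := by
      intro l hl
      rw [hA k (Finset.mem_range.1 hk) l (Finset.mem_range.1 hl)]
      simp only [hv, hg]
      split_ifs
      · ring
      · simp
    rw [Finset.sum_congr rfl this, ← Finset.mul_sum, norm_mul, hu k (Finset.mem_range.1 hk),
      one_mul]
  have hle : ellTwo (Finset.range N) (fun k => ∑ l ∈ Finset.range N, A k l * v l) ≤
      ‖T (finiteVector b Y f)‖ := by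
    refine le_trans (le_of_eq ?_) (ellTwo_inner_le b ((Finset.range N).image s) _)
    rw [ellTwo, ellTwo, Finset.sum_image hs]
    congr 1
    exact Finset.sum_congr rfl fun k hk => by rw [hcoef k hk]
  rw [hnorm]
  refine (h v fun k hk hvk => ?_).trans hle
  by_cases hkY : s k ∈ Y
  · obtain ⟨l, hl, hlk, hIl⟩ := hY _ hkY
    rwa [← hs (Finset.mem_coe.2 (Finset.mem_range.2 hl)) (Finset.mem_coe.2 (Finset.mem_range.2 hk))
      hlk]
  · simp [hv, hg, hkY] at hvk

/-- A lower bound for `T` gives a singular value bound for the matrix of `T` on finitely many sites,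
up to the part of `T φ` outside these sites. -/
theorem singularBound_of_forall_le (hs : Set.InjOn s (Finset.range N)) {δ : ℝ}
    (h : ∀ ψ, t * ‖ψ‖ ≤ ‖T ψ‖) (htail : ∀ (Y X : Finset ι) (f : ι → ℂ),
      (∀ y ∈ Y, ∃ k < N, s k = y ∧ I k) → (∀ x, x ∈ X ↔ ∃ k < N, s k = x) →
      ‖T (finiteVector b Y f)‖ ≤ ellTwo X (fun x => inner ℂ (b x) (T (finiteVector b Y f))) +
        δ * ‖finiteVector b Y f‖) :
    SingularBound N (fun k l => inner ℂ (b (s k)) (T (b (s l)))) I (t - δ) := by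
  classical
  intro v hv
  set J := (Finset.range N).filter fun k => I k with hJ
  have hJN : (J : Set ℕ) ⊆ Finset.range N := by
    intro k hk; exact (Finset.mem_filter.1 hk).1
  set f : ι → ℂ := fun y => if hy : ∃ k < N, s k = y then v hy.choose else 0 with hf
  have hfs : ∀ k < N, f (s k) = v k := by
    intro k hk
    have hy : ∃ l < N, s l = s k := ⟨k, hk, rfl⟩
    simp only [hf, dif_pos hy]
    congr 1
    exact hs (by simpa using hy.choose_spec.1) (by simpa using hk) hy.choose_spec.2
  have hv0 : ∀ k ∈ Finset.range N, k ∉ J → v k = 0 := by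
    intro k hk hkJ
    by_contra hne
    exact hkJ (Finset.mem_filter.2 ⟨hk, hv k (Finset.mem_range.1 hk) hne⟩)
  set φ := finiteVector b (J.image s) f with hφ
  have hnorm : ‖φ‖ = ellTwo (Finset.range N) v := by
    rw [hφ, norm_finiteVector, ellTwo, ellTwo, Finset.sum_image (hs.mono hJN)]
    congr 1
    exact (Finset.sum_congr rfl fun k hk => by rw [hfs k (Finset.mem_range.1 (hJN hk))]).trans
      (Finset.sum_subset (Finset.filter_subset _ _) fun k hk hkJ => by rw [hv0 k hk hkJ]; simp)
  have hcoef : ellTwo ((Finset.range N).image s) (fun x => inner ℂ (b x) (T φ)) =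
      ellTwo (Finset.range N) fun k =>
        ∑ l ∈ Finset.range N, inner ℂ (b (s k)) (T (b (s l))) * v l := by
    rw [ellTwo, ellTwo, Finset.sum_image hs]
    congr 1
    refine Finset.sum_congr rfl fun k hk => ?_
    rw [hφ, inner_finiteVector, Finset.sum_image (hs.mono hJN)]
    congr 2
    exact (Finset.sum_congr rfl fun k hk => by rw [hfs k (Finset.mem_range.1 (hJN hk))]).trans
      (Finset.sum_subset (Finset.filter_subset _ _) fun k hk hkJ => by rw [hv0 k hk hkJ]; simp)
  have h₁ := htail (J.image s) ((Finset.range N).image s) f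
    (fun y hy => by
      obtain ⟨k, hk, rfl⟩ := Finset.mem_image.1 hy
      exact ⟨k, Finset.mem_range.1 (hJN hk), rfl, (Finset.mem_filter.1 hk).2⟩)
    (fun x => by simp)
  rw [← hφ, hcoef] at h₁
  have h₂ := h φ
  rw [hnorm] at h₁ h₂
  linarith

end FiniteMatrices

/-! ### Lower norms from patches -/

section Patches

/-- The unit cell that contains the point `x`. -/
def cellOf {n : ℕ} (x : Fin n → ℝ) : Fin n → ℤ := fun i => ⌊x i⌋

theorem norm_cellOf_sub_le {n : ℕ} (x y : Fin n → ℝ) : ‖cellOf x - cellOf y‖ ≤ dist x y + 1 := by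
  refine (pi_norm_le_iff_of_nonneg (by positivity)).2 fun i => ?_
  have h := dist_le_pi_dist x y i
  rw [Real.dist_eq, abs_le] at h
  have h₁ := Int.floor_le (x i)
  have h₂ := Int.lt_floor_add_one (x i)
  have h₃ := Int.floor_le (y i)
  have h₄ := Int.lt_floor_add_one (y i)
  rw [Pi.sub_apply, Int.norm_eq_abs, abs_le]
  simp only [cellOf]
  push_cast
  constructor <;> linarith [h.1, h.2]

theorem dist_le_norm_cellOf_sub {n : ℕ} (x y : Fin n → ℝ) :
    dist x y ≤ ‖cellOf x - cellOf y‖ + 1 := by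
  refine (dist_pi_le_iff (by positivity)).2 fun i => ?_
  have h := norm_le_pi_norm (cellOf x - cellOf y) i
  rw [Pi.sub_apply, Int.norm_eq_abs, abs_le] at h
  simp only [cellOf] at h
  push_cast at h
  have h₁ := Int.floor_le (x i)
  have h₂ := Int.lt_floor_add_one (x i)
  have h₃ := Int.floor_le (y i)
  have h₄ := Int.lt_floor_add_one (y i)
  rw [Real.dist_eq, abs_le]
  constructor <;> linarith [h.1, h.2]

namespace DiscreteOperator

variable {n : ℕ} {H : DiscreteOperator.{u} n}

theorem entry_eq_inner (x y : H.sites) :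
    H.entry x y = inner ℂ (H.basis x) (H.op (H.basis y)) := by
  simp [entry]

theorem EquivalentActionVia.ncard_eq {t : Fin n → ℝ} {A B : Set (Fin n → ℝ)}
    (h : H.EquivalentActionVia t A B) : B.ncard = A.ncard := by
  rw [h.1]
  exact Set.ncard_image_of_injective _ (add_left_injective t)

/-- The operator `z - H`. -/
def shifted (H : DiscreteOperator.{u} n) (z : ℂ) : H.space →L[ℂ] H.space :=
  algebraMap ℂ (H.space →L[ℂ] H.space) z - H.op

theorem inner_shifted (z : ℂ) (x y : H.sites) :
    inner ℂ (H.basis x) (H.shifted z (H.basis y)) =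
      open scoped Classical in (if x = y then z else 0) - H.entry x y := by
  classical
  have h := orthonormal_iff_ite.1 H.basis.orthonormal x y
  rw [entry_eq_inner, shifted]
  simp only [Algebra.algebraMap_eq_smul_one, sub_apply,
    smul_apply, inner_sub_right, inner_smul_right]
  have h₁ : (1 : H.space →L[ℂ] H.space) (H.basis y) = H.basis y := rfl
  rw [h₁, h]
  split_ifs <;> simp

theorem inner_adjoint_shifted (z : ℂ) (x y : H.sites) :
    inner ℂ (H.basis x) (ContinuousLinearMap.adjoint (H.shifted z) (H.basis y)) =
      (starRingEnd ℂ) (inner ℂ (H.basis y) (H.shifted z (H.basis x))) := by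
  rw [ContinuousLinearMap.adjoint_inner_right, inner_conj_symm]

namespace LocalData

variable (D : H.LocalData)

theorem ncard_patch (L : ℕ) (m : Fin (D.numPatches L)) :
    (H.patch (L + 1) (D.center L m)).ncard = D.numPoints L m := by
  rw [← Nat.card_coe_set_eq, ← Nat.card_congr (D.point L m), Nat.card_fin]

theorem numPoints_pos (L : ℕ) (m : Fin (D.numPatches L)) : 0 < D.numPoints L m := by
  have : D.center L m ∈ H.patch (L + 1) (D.center L m) :=
    ⟨D.center_mem L m, Metric.mem_ball_self (by positivity)⟩
  have k := (D.point L m).symm ⟨_, this⟩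
  exact k.pos

/-- The `k`-th site of a patch (the centre of the patch if `k` is out of range). -/
def site (L : ℕ) (m : Fin (D.numPatches L)) (k : ℕ) : H.sites :=
  if h : k < D.numPoints L m then ⟨D.point L m ⟨k, h⟩, (D.point L m ⟨k, h⟩).2.1⟩
  else ⟨D.center L m, D.center_mem L m⟩

theorem coe_site_zero (L : ℕ) (m : Fin (D.numPatches L)) :
    (D.site L m 0 : Fin n → ℝ) = D.center L m := by
  simp [site, D.numPoints_pos L m, D.point_zero]

theorem site_mem_patch {L : ℕ} {m : Fin (D.numPatches L)} (k : ℕ) :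
    (D.site L m k : Fin n → ℝ) ∈ H.patch (L + 1) (D.center L m) := by
  unfold site
  split_ifs with h
  · exact (D.point L m ⟨k, h⟩).2
  · exact ⟨D.center_mem L m, Metric.mem_ball_self (by positivity)⟩

theorem site_injOn (L : ℕ) (m : Fin (D.numPatches L)) :
    Set.InjOn (D.site L m) (Finset.range (D.numPoints L m)) := by
  intro k hk l hl h
  simp only [Finset.coe_range, Set.mem_Iio] at hk hl
  simp only [site, dif_pos hk, dif_pos hl, Subtype.mk.injEq] at h
  simpa using (D.point L m).injective (Subtype.ext h)

theorem exists_site_eq {L : ℕ} {m : Fin (D.numPatches L)} {x : Fin n → ℝ}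
    (hx : x ∈ H.patch (L + 1) (D.center L m)) :
    ∃ k < D.numPoints L m, (D.site L m k : Fin n → ℝ) = x := by
  refine ⟨(D.point L m).symm ⟨x, hx⟩, Fin.is_lt _, ?_⟩
  simp [site]

theorem point?_eq {L : ℕ} (m : Fin (D.numPatches L)) {k : ℕ} (hk : k < D.numPoints L m) :
    D.point? L m k = some (D.site L m k : Fin n → ℝ) := by
  simp [point?, site, hk]

/-- Numbers that dominate the local data: `K` sites at most in a unit cell, matrix elements
and short-range constant at most `M`, and short-range exponent at least `1 / (q + 1)`. -/
structure Dominated (q K M : ℕ) : Prop where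
  numPoints_le : ∀ m, D.numPoints 0 m ≤ K
  normBound_le : D.normBound ≤ M
  decayConst_le : D.decayConst ≤ M
  le_decayExp : 1 / ((q : ℝ) + 1) ≤ D.decayExp

variable {D} {q K M : ℕ}

theorem Dominated.norm_entry_le (h : D.Dominated q K M) (x y : H.sites) (hxy : x ≠ y) :
    ‖H.entry x y‖ ≤ M * decayProfile n q (cellOf (x : Fin n → ℝ) - cellOf (y : Fin n → ℝ)) := by
  set u := cellOf (x : Fin n → ℝ) - cellOf (y : Fin n → ℝ) with hu
  have hud := norm_cellOf_sub_le (x : Fin n → ℝ) y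
  rw [← hu] at hud
  rcases le_or_gt ‖u‖ 2 with h2 | h2
  · have h1 : decayProfile n q u = 1 := by
      rw [decayProfile, max_eq_left (by linarith), Real.one_rpow]
    rw [h1, mul_one, entry_eq_inner]
    calc ‖inner ℂ (H.basis x) (H.op (H.basis y))‖ ≤ ‖H.basis x‖ * ‖H.op (H.basis y)‖ :=
          norm_inner_le_norm _ _
      _ ≤ 1 * (‖H.op‖ * 1) := by
          rw [H.basis.orthonormal.1 x]
          gcongr
          exact (H.op.le_opNorm _).trans (by rw [H.basis.orthonormal.1 y])
      _ ≤ M := by rw [one_mul, mul_one]; exact D.norm_le.trans h.normBound_le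
  · have hd1 : 1 ≤ dist (x : Fin n → ℝ) y := by linarith
    have hne : (x : Fin n → ℝ) ≠ y := fun e => hxy (Subtype.ext e)
    refine (D.decayBound x x.2 y y.2 hne).trans ?_
    refine mul_le_mul h.decayConst_le ?_ (by positivity) (Nat.cast_nonneg _)
    rw [decayProfile, max_eq_right (by linarith)]
    calc dist (x : Fin n → ℝ) y ^ (-((n : ℝ) + D.decayExp))
        ≤ dist (x : Fin n → ℝ) y ^ (-((n : ℝ) + 1 / ((q : ℝ) + 1))) :=
          Real.rpow_le_rpow_of_exponent_le hd1 (by linarith [h.le_decayExp])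
      _ ≤ (‖u‖ - 1) ^ (-((n : ℝ) + 1 / ((q : ℝ) + 1))) := by
          refine Real.rpow_le_rpow_of_nonpos (by linarith) (by linarith) ?_
          have : (0 : ℝ) ≤ 1 / ((q : ℝ) + 1) := by positivity
          have hn : (0 : ℝ) ≤ n := Nat.cast_nonneg n
          linarith

theorem Dominated.card_le (h : D.Dominated q K M) (s : Finset H.sites) (u : Fin n → ℤ)
    (hs : ∀ x ∈ s, cellOf (x : Fin n → ℝ) = u) : s.card ≤ K := by
  rcases s.eq_empty_or_nonempty with rfl | ⟨p, hp⟩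
  · simp
  obtain ⟨m, hm, -⟩ := D.existsUnique_patch 0 p p.2
  have hfin : (H.patch ((0 : ℕ) + 1) (p : Fin n → ℝ)).Finite := by
    rw [hm.1]
    exact (Set.finite_coe_iff.1 (Finite.of_equiv _ (D.point 0 m))).image _
  have hsub : ((fun x : H.sites => (x : Fin n → ℝ)) '' (s : Set H.sites)) ⊆
      H.patch ((0 : ℕ) + 1) (p : Fin n → ℝ) := by
    rintro _ ⟨x, hx, rfl⟩
    refine ⟨x.2, ?_⟩
    rw [Metric.mem_ball, dist_pi_lt_iff (by norm_num)]
    intro i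
    have h₁ : ⌊(x : Fin n → ℝ) i⌋ = ⌊(p : Fin n → ℝ) i⌋ :=
      (congrFun (hs x hx) i).trans (congrFun (hs p hp) i).symm
    simpa [Real.dist_eq] using Int.abs_sub_lt_one_of_floor_eq_floor h₁
  have h₁ := Set.ncard_le_ncard hsub hfin
  rw [Set.ncard_image_of_injective _ Subtype.val_injective, Set.ncard_coe_finset, hm.ncard_eq,
    D.ncard_patch] at h₁
  exact h₁.trans (h.numPoints_le m)

theorem Dominated.isShortRangeMatrix_shifted (h : D.Dominated q K M) (z : ℂ) :
    IsShortRangeMatrix (fun x : H.sites => cellOf (x : Fin n → ℝ)) q K M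
      fun x y => inner ℂ (H.basis x) (H.shifted z (H.basis y)) where
  card_le := h.card_le
  norm_le x y hxy := by
    rw [inner_shifted, if_neg hxy, zero_sub, norm_neg]
    exact h.norm_entry_le x y hxy

theorem Dominated.isShortRangeMatrix_adjoint (h : D.Dominated q K M) (z : ℂ) :
    IsShortRangeMatrix (fun x : H.sites => cellOf (x : Fin n → ℝ)) q K M
      fun x y => inner ℂ (H.basis x) (ContinuousLinearMap.adjoint (H.shifted z) (H.basis y)) where
  card_le := h.card_le
  norm_le x y hxy := by
    rw [inner_adjoint_shifted, RCLike.norm_conj, ← decayProfile_neg, neg_sub]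
    exact (h.isShortRangeMatrix_shifted z).norm_le y x hxy.symm

end LocalData

end DiscreteOperator

end Patches

/-! ### Lower norms from approximate answers -/

section ApproximatePatches

/-- The natural number nearest to `r`. -/
def natValue (r : ℝ) : ℕ := ⌊r + 1 / 2⌋₊

theorem natValue_eq {r : ℝ} {N : ℕ} (h : |r - N| < 1 / 2) : natValue r = N := by
  rw [abs_lt] at h
  have hN : (0 : ℝ) ≤ N := Nat.cast_nonneg N
  rw [natValue, Nat.floor_eq_iff (by linarith)]
  constructor <;> linarith

/-- The matrix of `z - H` on the `m`-th patch of size `L + 1`, computed from approximate answers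
`α`. -/
def patchMatrix (α : EvalIndex → ℝ) (L m : ℕ) (z : ℂ) (k l : ℕ) : ℂ :=
  (if k = l then z else 0) - ⟨α (.entryRe L m k l), α (.entryIm L m k l)⟩

/-- According to the approximate answers `α`, the `k`-th point of the `m`-th patch of size `L + 1`
lies in the cube of side `2 * R + 1` around the centre of the patch. The additional margin of
`1 / 2` makes up for the errors of the coordinates: all points at distance less than `R` from the
centre satisfy this condition, and no points at distance `R + 1` or more. -/
def IsInnerPoint (n : ℕ) (α : EvalIndex → ℝ) (L R m k : ℕ) : Prop :=
  ∀ i < n, |α (.coord L m k i) - α (.coord L m 0 i)| < R + 1 / 2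

/-- On all patches of size `L + 1`, the matrices of `z - H` and of its adjoint, computed from
approximate answers `α`, are bounded below by `t` on the vectors supported in the inner points.
This is a condition on finitely many smallest singular values. -/
def PatchBound (n : ℕ) (α : EvalIndex → ℝ) (L R : ℕ) (z : ℂ) (t : ℝ) : Prop :=
  ∀ m < natValue (α (.numPatches L)),
    SingularBound (natValue (α (.numPoints L m))) (patchMatrix α L m z)
      (IsInnerPoint n α L R m) t ∧
    SingularBound (natValue (α (.numPoints L m)))
      (fun k l => (starRingEnd ℂ) (patchMatrix α L m z l k)) (IsInnerPoint n α L R m) t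

namespace DiscreteOperator.LocalData

variable {n : ℕ} {H : DiscreteOperator.{u} n}

/-- The numbers `α` approximate the answers about the patches of size `L + 1` with the error `θ`,
and there are at most `B` such patches, with at most `B` points each. -/
structure Approximates (D : H.LocalData) (α : EvalIndex → ℝ) (L B : ℕ) (θ : ℝ) : Prop where
  nonneg : 0 ≤ θ
  le_quarter : θ ≤ 1 / 4
  numPatches_eq : natValue (α (.numPatches L)) = D.numPatches L
  numPoints_eq : ∀ m : Fin (D.numPatches L), natValue (α (.numPoints L m)) = D.numPoints L m
  numPoints_le : ∀ m : Fin (D.numPatches L), D.numPoints L m ≤ B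
  entryRe_le : ∀ (m : Fin (D.numPatches L)), ∀ k < D.numPoints L m, ∀ l < D.numPoints L m,
    |(H.entry (D.site L m k) (D.site L m l)).re - α (.entryRe L m k l)| ≤ θ
  entryIm_le : ∀ (m : Fin (D.numPatches L)), ∀ k < D.numPoints L m, ∀ l < D.numPoints L m,
    |(H.entry (D.site L m k) (D.site L m l)).im - α (.entryIm L m k l)| ≤ θ
  coord_le : ∀ (m : Fin (D.numPatches L)), ∀ k < D.numPoints L m, ∀ i : Fin n,
    |(D.site L m k : Fin n → ℝ) i - α (.coord L m k i)| ≤ θ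

variable {D : H.LocalData} {α : EvalIndex → ℝ} {L B : ℕ} {θ : ℝ}

theorem inner_shifted_site (z : ℂ) (m : Fin (D.numPatches L)) {k l : ℕ}
    (hk : k < D.numPoints L m) (hl : l < D.numPoints L m) :
    inner ℂ (H.basis (D.site L m k)) (H.shifted z (H.basis (D.site L m l))) =
      (if k = l then z else 0) - H.entry (D.site L m k) (D.site L m l) := by
  classical
  rw [inner_shifted]
  congr 1
  by_cases h : k = l
  · simp [h]
  · have : D.site L m k ≠ D.site L m l := fun e => h (D.site_injOn L m (by simpa using hk)
      (by simpa using hl) e)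
    simp [h, this]

theorem Approximates.norm_sub_patchMatrix_le (h : D.Approximates α L B θ) (z : ℂ)
    (m : Fin (D.numPatches L)) {k l : ℕ}
    (hk : k < D.numPoints L m) (hl : l < D.numPoints L m) :
    ‖inner ℂ (H.basis (D.site L m k)) (H.shifted z (H.basis (D.site L m l))) -
      patchMatrix α L m z k l‖ ≤ 2 * θ := by
  rw [inner_shifted_site z m hk hl, patchMatrix, sub_sub_sub_cancel_left, norm_sub_rev]
  refine (Complex.norm_le_abs_re_add_abs_im _).trans ?_
  have h₁ := h.entryRe_le m k hk l hl
  have h₂ := h.entryIm_le m k hk l hl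
  simp only [Complex.sub_re, Complex.sub_im]
  linarith

theorem Approximates.isInnerPoint (h : D.Approximates α L B θ) {R : ℕ}
    {m : Fin (D.numPatches L)} {k : ℕ} (hk : k < D.numPoints L m)
    (hd : ∀ i, |(D.site L m k : Fin n → ℝ) i - D.center L m i| < R) :
    IsInnerPoint n α L R m k := by
  intro i hi
  have h₁ := h.coord_le m k hk ⟨i, hi⟩
  have h₂ := h.coord_le m 0 (D.numPoints_pos L m) ⟨i, hi⟩
  have h₃ := hd ⟨i, hi⟩
  rw [coe_site_zero] at h₂
  have := h.le_quarter
  rw [abs_le] at h₁ h₂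
  rw [abs_lt] at h₃ ⊢
  constructor <;> linarith [h₁.1, h₁.2, h₂.1, h₂.2, h₃.1, h₃.2]

theorem Approximates.dist_lt (h : D.Approximates α L B θ) {R : ℕ}
    {m : Fin (D.numPatches L)} {k : ℕ} (hk : k < D.numPoints L m)
    (hI : IsInnerPoint n α L R m k) :
    dist (D.site L m k : Fin n → ℝ) (D.center L m) < R + 1 := by
  rw [dist_pi_lt_iff (by positivity)]
  intro i
  have h₁ := h.coord_le m k hk i
  have h₂ := h.coord_le m 0 (D.numPoints_pos L m) i
  have h₃ := hI i i.2
  rw [coe_site_zero] at h₂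
  have := h.le_quarter
  rw [Real.dist_eq]
  rw [abs_le] at h₁ h₂
  rw [abs_lt] at h₃ ⊢
  constructor <;> linarith [h₁.1, h₁.2, h₂.1, h₂.2, h₃.1, h₃.2]

theorem Approximates.sq_mul_le (h : D.Approximates α L B θ) (m : Fin (D.numPatches L)) :
    (D.numPoints L m : ℝ) ^ 2 * (2 * θ) ≤ B ^ 2 * (2 * θ) := by
  have h₁ := h.nonneg
  have h₂ : (D.numPoints L m : ℝ) ≤ B := by exact_mod_cast h.numPoints_le m
  gcongr

/-- Every patch of size `L + 1` around a site is, up to phases, a copy of one of the enumerated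
patches. -/
theorem exists_patch_copy (D : H.LocalData) (L : ℕ) (p : H.sites) :
    ∃ (m : Fin (D.numPatches L)) (s : ℕ → H.sites) (φ : ℕ → ℂ),
      Set.InjOn s (Finset.range (D.numPoints L m)) ∧
      (∀ k < D.numPoints L m, ‖φ k‖ = 1) ∧
      (∀ k < D.numPoints L m, (s k : Fin n → ℝ) = D.site L m k + (p - D.center L m)) ∧
      (∀ k < D.numPoints L m, ∀ l < D.numPoints L m, H.entry (s k) (s l) =
        φ k * H.entry (D.site L m k) (D.site L m l) * (starRingEnd ℂ) (φ l)) ∧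
      ∀ y : H.sites, dist (y : Fin n → ℝ) p < L + 1 → ∃ k < D.numPoints L m, s k = y := by
  obtain ⟨m, ⟨himg, U, hU, hent⟩, -⟩ := D.existsUnique_patch L p p.2
  have hmem : ∀ k, (D.site L m k : Fin n → ℝ) + (p - D.center L m) ∈ H.patch (L + 1) p := by
    intro k
    rw [himg]
    exact ⟨_, D.site_mem_patch k, rfl⟩
  refine ⟨m, fun k => ⟨_, (hmem k).1⟩, fun k => U (D.site L m k), fun k hk l hl h => ?_,
    fun k _ => hU _ (D.site_mem_patch k), fun k _ => rfl,
    fun k _ l _ => hent _ (D.site_mem_patch k) _ (D.site_mem_patch l), fun y hy => ?_⟩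
  · have h' := congrArg Subtype.val h
    exact D.site_injOn L m hk hl (Subtype.ext (add_right_cancel h'))
  · have hy' : (y : Fin n → ℝ) ∈ H.patch (L + 1) p := ⟨y.2, hy⟩
    rw [himg] at hy'
    obtain ⟨a, ha, hay⟩ := hy'
    obtain ⟨k, hk, rfl⟩ := D.exists_site_eq ha
    exact ⟨k, hk, Subtype.ext hay⟩

/-- Lower bounds on the patches give a lower bound for the lower norm function. -/
theorem Approximates.le_lowerNorm (h : D.Approximates α L B θ) {q K M : ℕ}
    (hD : D.Dominated q K M) {R : ℕ} (hR : 0 < R) (hRL : R ≤ L) {z : ℂ} {t : ℝ}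
    (hb : PatchBound n α L R z t) :
    t - (schurBound n q K M (cubeWeight n R) + B ^ 2 * (2 * θ)) ≤ lowerNorm H.op z := by
  have := H.nontrivial_space
  set δ := schurBound n q K M (cubeWeight n R) with hδ
  rcases le_or_gt (t - (δ + B ^ 2 * (2 * θ))) 0 with h0 | h0
  · exact h0.trans (lowerNorm_nonneg _ _)
  -- The sites in a cube of side `R` lie in one patch, which is a copy of an enumerated one.
  have hcell : ∀ (Y : Finset H.sites), (∀ x ∈ Y, ∀ y ∈ Y, ∀ i,
      |cellOf (x : Fin n → ℝ) i - cellOf (y : Fin n → ℝ) i| < R) → Y.Nonempty →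
      ∃ (m : Fin (D.numPatches L)) (s : ℕ → H.sites) (φ : ℕ → ℂ),
        Set.InjOn s (Finset.range (D.numPoints L m)) ∧ (∀ k < D.numPoints L m, ‖φ k‖ = 1) ∧
        (∀ k < D.numPoints L m, ∀ l < D.numPoints L m,
          inner ℂ (H.basis (s k)) (H.shifted z (H.basis (s l))) =
          φ k * inner ℂ (H.basis (D.site L m k)) (H.shifted z (H.basis (D.site L m l))) *
            (starRingEnd ℂ) (φ l)) ∧
        ∀ y ∈ Y, ∃ k < D.numPoints L m, s k = y ∧ IsInnerPoint n α L R m k := by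
    rintro Y hY ⟨p, hp⟩
    have hdist : ∀ y ∈ Y, ∀ i, |(y : Fin n → ℝ) i - (p : Fin n → ℝ) i| < R := by
      intro y hy i
      have h₁ := hY y hy p hp i
      have h₂ : |cellOf (y : Fin n → ℝ) i - cellOf (p : Fin n → ℝ) i| ≤ R - 1 := by omega
      have h₃ : |((cellOf (y : Fin n → ℝ) i : ℤ) : ℝ) - (cellOf (p : Fin n → ℝ) i : ℤ)| ≤
          (R : ℝ) - 1 := by exact_mod_cast h₂
      simp only [cellOf] at h₃
      rw [abs_le] at h₃
      have e₁ := Int.floor_le ((y : Fin n → ℝ) i)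
      have e₂ := Int.lt_floor_add_one ((y : Fin n → ℝ) i)
      have e₃ := Int.floor_le ((p : Fin n → ℝ) i)
      have e₄ := Int.lt_floor_add_one ((p : Fin n → ℝ) i)
      rw [abs_lt]
      constructor <;> linarith [h₃.1, h₃.2]
    obtain ⟨m, s, φ, hinj, hφ, hs, hent, hall⟩ := D.exists_patch_copy L p
    refine ⟨m, s, φ, hinj, hφ, fun k hk l hl => ?_, fun y hy => ?_⟩
    · rw [inner_shifted_site z m hk hl, inner_shifted, hent k hk l hl]
      have h₁ : (starRingEnd ℂ) (φ l) * φ l = 1 := by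
        rw [← Complex.normSq_eq_conj_mul_self, Complex.normSq_eq_norm_sq, hφ l hl]; simp
      by_cases hkl : k = l
      · subst hkl
        simp only [if_true]
        linear_combination -z * h₁
      · have : s k ≠ s l := fun e => hkl (hinj (by simpa using hk) (by simpa using hl) e)
        simp only [hkl, this, if_false]
        ring
    · have hlt : dist (y : Fin n → ℝ) p < L + 1 := by
        have hRL' : (R : ℝ) ≤ L := by exact_mod_cast hRL
        rw [dist_pi_lt_iff (by positivity)]
        intro i
        rw [Real.dist_eq]
        linarith [hdist y hy i]
      obtain ⟨k, hk, rfl⟩ := hall y hlt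
      refine ⟨k, hk, rfl, h.isInnerPoint hk fun i => ?_⟩
      have := hdist _ hy i
      rw [hs k hk] at this
      simp only [Pi.add_apply, Pi.sub_apply] at this
      convert this using 2
      ring
  have hbm : ∀ m : Fin (D.numPatches L),
      SingularBound (D.numPoints L m) (fun k l => inner ℂ (H.basis (D.site L m k))
        (H.shifted z (H.basis (D.site L m l)))) (IsInnerPoint n α L R m)
        (t - B ^ 2 * (2 * θ)) ∧
      SingularBound (D.numPoints L m) (fun k l => (starRingEnd ℂ)
        (inner ℂ (H.basis (D.site L m l)) (H.shifted z (H.basis (D.site L m k)))))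
        (IsInnerPoint n α L R m) (t - B ^ 2 * (2 * θ)) := by
    intro m
    have hm := hb m (by rw [h.numPatches_eq]; exact m.2)
    rw [h.numPoints_eq m] at hm
    have h2θ : 0 ≤ 2 * θ := by linarith [h.nonneg]
    constructor
    · refine SingularBound.mono (sub_le_sub_left (h.sq_mul_le m) t)
        (hm.1.perturb h2θ fun k hk l hl => ?_)
      rw [norm_sub_rev]
      exact h.norm_sub_patchMatrix_le z m hk hl
    · refine SingularBound.mono (sub_le_sub_left (h.sq_mul_le m) t)
        (hm.2.perturb h2θ fun k hk l hl => ?_)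
      rw [← map_sub, RCLike.norm_conj, norm_sub_rev]
      exact h.norm_sub_patchMatrix_le z m hl hk
  refine (le_lowerNorm_iff h0).2 ⟨fun ψ => ?_, fun ψ => ?_⟩
  · have := (hD.isShortRangeMatrix_shifted z).le_norm_of_forall_cube H.basis hR
      (t := t - B ^ 2 * (2 * θ)) (fun Y f hY => ?_) ψ
    · rw [← hδ] at this
      refine le_trans (le_of_eq ?_) this
      ring
    · rcases Y.eq_empty_or_nonempty with rfl | hne
      · simp [finiteVector]
      obtain ⟨m, s, φ, hinj, hφ, hent, hin⟩ := hcell Y hY hne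
      exact (hbm m).1.le_norm_finiteVector H.basis _ hinj hφ hent hin f
  · have := (hD.isShortRangeMatrix_adjoint z).le_norm_of_forall_cube H.basis hR
      (t := t - B ^ 2 * (2 * θ)) (fun Y f hY => ?_) ψ
    · rw [← hδ] at this
      refine le_trans (le_of_eq ?_) this
      ring
    · rcases Y.eq_empty_or_nonempty with rfl | hne
      · simp [finiteVector]
      obtain ⟨m, s, φ, hinj, hφ, hent, hin⟩ := hcell Y hY hne
      refine (hbm m).2.le_norm_finiteVector H.basis _ hinj hφ (fun k hk l hl => ?_) hin f
      rw [inner_adjoint_shifted, hent l hl k hk, map_mul, map_mul, Complex.conj_conj]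
      ring

/-- A lower bound for the lower norm function gives lower bounds on the patches. -/
theorem Approximates.patchBound (h : D.Approximates α L B θ) {q K M : ℕ}
    (hD : D.Dominated q K M) (R : ℕ) {z : ℂ} {t : ℝ}
    (ht : t ≤ lowerNorm H.op z) :
    PatchBound n α L R z
      (t - (schurBound n q K M (tailWeight (L - (R + 1 : ℕ))) + B ^ 2 * (2 * θ))) := by
  have := H.nontrivial_space
  set δ := schurBound n q K M (tailWeight (n := n) (L - (R + 1 : ℕ))) with hδ
  have hδ0 : 0 ≤ δ := schurBound_nonneg ..
  have h2θ : 0 ≤ 2 * θ := by linarith [h.nonneg]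
  intro m' hm'
  rw [h.numPatches_eq] at hm'
  obtain ⟨m, rfl⟩ : ∃ m : Fin (D.numPatches L), m' = m := ⟨⟨m', hm'⟩, rfl⟩
  rw [h.numPoints_eq m]
  rcases le_or_gt t 0 with h0 | h0
  · have : t - (δ + B ^ 2 * (2 * θ)) ≤ 0 := by
      have : 0 ≤ (B : ℝ) ^ 2 * (2 * θ) := by positivity
      linarith
    exact ⟨.of_nonpos _ _ _ this, .of_nonpos _ _ _ this⟩
  obtain ⟨h₁, h₂⟩ := (le_lowerNorm_iff h0).1 ht
  have htail : ∀ T : H.space →L[ℂ] H.space,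
      IsShortRangeMatrix (fun x : H.sites => cellOf (x : Fin n → ℝ)) q K M
        (fun x y => inner ℂ (H.basis x) (T (H.basis y))) →
      ∀ (Y X : Finset H.sites) (f : H.sites → ℂ),
      (∀ y ∈ Y, ∃ k < D.numPoints L m, D.site L m k = y ∧ IsInnerPoint n α L R m k) →
      (∀ x, x ∈ X ↔ ∃ k < D.numPoints L m, D.site L m k = x) →
      ‖T (finiteVector H.basis Y f)‖ ≤
        ellTwo X (fun x => inner ℂ (H.basis x) (T (finiteVector H.basis Y f))) +
        δ * ‖finiteVector H.basis Y f‖ := by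
    intro T hT Y X f hY hX
    refine hT.norm_le_ellTwo_add H.basis X Y (fun x hx y hy => ?_) (fun y hy => ?_) f
    · obtain ⟨k, hk, rfl, hI⟩ := hY y hy
      have e₁ := h.dist_lt hk hI
      have e₂ : (L : ℝ) + 1 ≤ dist (x : Fin n → ℝ) (D.center L m) := by
        by_contra hlt
        obtain ⟨l, hl, hlx⟩ := D.exists_site_eq
          (show (x : Fin n → ℝ) ∈ H.patch (L + 1) (D.center L m) from ⟨x.2, not_le.1 hlt⟩)
        exact hx ((hX x).2 ⟨l, hl, Subtype.ext hlx⟩)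
      have e₃ := dist_triangle (x : Fin n → ℝ) (D.site L m k : Fin n → ℝ) (D.center L m)
      have e₄ := dist_le_norm_cellOf_sub (x : Fin n → ℝ) (D.site L m k : Fin n → ℝ)
      push_cast
      linarith
    · obtain ⟨k, hk, rfl, -⟩ := hY y hy
      exact (hX _).2 ⟨k, hk, rfl⟩
  constructor
  · have h₃ := singularBound_of_forall_le H.basis (H.shifted z) (D.site_injOn L m) h₁
      (htail _ (hD.isShortRangeMatrix_shifted z))
    refine SingularBound.mono ?_ (h₃.perturb h2θ fun k hk l hl =>
      h.norm_sub_patchMatrix_le z m hk hl)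
    linarith [h.sq_mul_le m]
  · have h₃ := singularBound_of_forall_le H.basis (ContinuousLinearMap.adjoint (H.shifted z))
      (D.site_injOn L m) h₂ (htail _ (hD.isShortRangeMatrix_adjoint z))
    refine SingularBound.mono ?_ (h₃.perturb h2θ fun k hk l hl => ?_)
    · linarith [h.sq_mul_le m]
    · rw [inner_adjoint_shifted, ← map_sub, RCLike.norm_conj]
      exact h.norm_sub_patchMatrix_le z m hl hk

end DiscreteOperator.LocalData

end ApproximatePatches

/-! ### Certificates -/

/-- The first position of an index in the enumeration of the evaluation functions. -/
def EvalIndex.position (e : EvalIndex) : ℕ := sInf {j | EvalIndex.ofNat j = e}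

theorem EvalIndex.ofNat_position (e : EvalIndex) : EvalIndex.ofNat e.position = e :=
  Nat.sInf_mem (s := {j | EvalIndex.ofNat j = e}) (EvalIndex.ofNat_surjective e)

/-- The evaluation functions that concern the number and the sizes of the patches of size `1`, all
data of the patches of size `L + 1`, and the constants, for at most `B` patches with at most `B`
points. -/
def relevantIndices (n L B : ℕ) : List EvalIndex :=
  [.numPatches 0, .numPatches L, .normBound, .decayConst, .decayExp, .level] ++
    (List.range B).flatMap fun m => [.numPoints 0 m, .numPoints L m] ++
      (List.range B).flatMap fun k =>
        ((List.range n).map fun i => EvalIndex.coord L m k i) ++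
        (List.range B).flatMap fun l => [.entryRe L m k l, .entryIm L m k l]

theorem numPoints_mem_relevantIndices {n L B L' m : ℕ} (hL : L' = 0 ∨ L' = L) (hm : m < B) :
    .numPoints L' m ∈ relevantIndices n L B := by
  simp only [relevantIndices, List.mem_append, List.mem_flatMap, List.mem_range]
  refine .inr ⟨m, hm, .inl ?_⟩
  rcases hL with rfl | rfl <;> simp

/-- Rational approximations of the first answers, with a common error `1 / (precision + 1)`, and
finitely many rational points of the complex plane, which are meant to approximate the
pseudospectrum. -/
structure Certificate where
  answers : List ℚ
  precision : ℕ
  points : List (ℚ × ℚ)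

namespace Certificate

instance : Countable Certificate :=
  Function.Injective.countable (f := fun c => (c.answers, c.precision, c.points)) <| by
    rintro ⟨_, _, _⟩ ⟨_, _, _⟩ h
    simpa using h

variable (c : Certificate)

/-- The error of the approximate answers. -/
def error : ℝ := 1 / ((c.precision : ℝ) + 1)

theorem error_pos : 0 < c.error := by unfold error; positivity

/-- The approximate answers, as a function of the index (with the value `0` for the indices beyond
the length of the list). -/
def approx (e : EvalIndex) : ℝ := (c.answers.getD e.position 0 : ℚ)

/-- The answers that are compatible with the approximate ones. -/
def box : List (ℝ × ℝ) := c.answers.map fun r : ℚ => ((r : ℝ) - c.error, (r : ℝ) + c.error)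

/-- The real and imaginary parts of the points. -/
def output : List ℝ := c.points.flatMap fun q : ℚ × ℚ => [(q.1 : ℝ), (q.2 : ℝ)]

/-- The conditions under which the points of a certificate are accepted as an approximation with
error `2 ^ (-k)`. They refer to the data of the certificate alone: patches of size `L + 1` are
used, with inner points at distance about `R` from the centre, and the numbers `K`, `M` and `q`
dominate the local data in the sense of `DiscreteOperator.LocalData.Dominated`. The terms with
`schurBound` bound the errors of the localization, those with `c.error` the effect of the errors of
the answers. -/
structure IsValidWith (n k L R B q K M : ℕ) : Prop where
  pos : 0 < R
  le : R ≤ L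
  error_le : c.error ≤ 1 / 4
  position_lt : ∀ e ∈ relevantIndices n L B, e.position < c.answers.length
  numPatches_zero_le : natValue (c.approx (.numPatches 0)) ≤ B
  numPatches_le : natValue (c.approx (.numPatches L)) ≤ B
  numPoints_zero_le : ∀ m < B, natValue (c.approx (.numPoints 0 m)) ≤ K
  numPoints_le : ∀ m < B, natValue (c.approx (.numPoints L m)) ≤ B
  normBound_le : c.approx .normBound + c.error ≤ M
  decayConst_le : c.approx .decayConst + c.error ≤ M
  le_decayExp : 1 / ((q : ℝ) + 1) + c.error ≤ c.approx .decayExp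
  /-- The points belong to the pseudospectrum. -/
  inner : ∀ w ∈ c.points, ¬ PatchBound n c.approx L R (ratPoint w) (c.approx .level - c.error -
    (schurBound n q K M (tailWeight (L - (R + 1 : ℕ))) + B ^ 2 * (2 * c.error)))
  /-- The numbers that are not close to any of the points do not belong to the pseudospectrum. -/
  outer : ∀ z, PatchBound n c.approx L R z (c.approx .level + 2 * c.error +
      (schurBound n q K M (cubeWeight n R) + B ^ 2 * (2 * c.error))) ∨
    ∃ w ∈ c.points, dist z (ratPoint w) ≤ (2 : ℝ) ^ (-(k : ℤ))

/-- The certificate is accepted, for some choice of the parameters. -/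
def IsValid (n k : ℕ) : Prop := ∃ L R B q K M : ℕ, c.IsValidWith n k L R B q K M

theorem even_length_output : Even c.output.length := by
  unfold output
  induction c.points with
  | nil => simp
  | cons q l ih =>
    simp only [List.flatMap_cons, List.length_append, List.length_cons, List.length_nil]
    exact (by decide : Even (0 + 1 + 1)).add ih

theorem mem_pointsOfList_output (z : ℂ) :
    z ∈ pointsOfList c.output ↔ ∃ w ∈ c.points, ratPoint w = z := by
  unfold output
  induction c.points with
  | nil => simp [pointsOfList]
  | cons q l ih =>
    rw [List.flatMap_cons]
    simp only [List.cons_append, List.nil_append, pointsOfList, Finset.mem_insert, ih,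
      List.exists_mem_cons_iff]
    rw [eq_comm, ratPoint]

variable {c}

theorem abs_sub_approx_le {a : ℕ → ℝ} (ha : InBox c.box a) {e : EvalIndex}
    (he : e.position < c.answers.length) : |a e.position - c.approx e| ≤ c.error := by
  have h := ha e.position (by simpa [box] using he)
  simp only [box, List.getElem_map] at h
  rw [approx, List.getD_eq_getElem _ _ he, abs_le]
  constructor <;> linarith [h.1, h.2]

variable {n k : ℕ} {H : DiscreteOperator.{u} n} {D : H.LocalData} {ε : ℝ}

/-- The answers about the patches of size `L + 1` and the approximate answers of a certificate
agree up to the error. -/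
theorem approximates {L B : ℕ} (hθ : c.error ≤ 1 / 4)
    (hrel : ∀ e ∈ relevantIndices n L B, |D.eval ε e - c.approx e| ≤ c.error)
    (hB : D.numPatches L ≤ B) (hB' : ∀ m, D.numPoints L m ≤ B) :
    D.Approximates c.approx L B c.error where
  nonneg := c.error_pos.le
  le_quarter := hθ
  numPatches_eq := by
    refine natValue_eq ?_
    rw [abs_sub_comm]
    exact (hrel (.numPatches L) (by simp [relevantIndices])).trans_lt (by linarith)
  numPoints_eq m := by
    refine natValue_eq ?_
    have h := hrel (.numPoints L m) (numPoints_mem_relevantIndices (.inr rfl) (m.2.trans_le hB))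
    rw [abs_sub_comm]
    simp only [DiscreteOperator.LocalData.eval, m.2, dif_pos] at h
    exact h.trans_lt (by linarith)
  numPoints_le := hB'
  entryRe_le m i hi j hj := by
    have h := hrel (.entryRe L m i j) (by
      simp [relevantIndices, m.2.trans_le hB, hi.trans_le (hB' m), hj.trans_le (hB' m)])
    simpa only [DiscreteOperator.LocalData.eval, D.point?_eq m hi, D.point?_eq m hj] using h
  entryIm_le m i hi j hj := by
    have h := hrel (.entryIm L m i j) (by
      simp [relevantIndices, m.2.trans_le hB, hi.trans_le (hB' m), hj.trans_le (hB' m)])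
    simpa only [DiscreteOperator.LocalData.eval, D.point?_eq m hi, D.point?_eq m hj] using h
  coord_le m j hj i := by
    have h := hrel (.coord L m j i) (by
      simp [relevantIndices, m.2.trans_le hB, hj.trans_le (hB' m)])
    simpa only [DiscreteOperator.LocalData.eval, D.point?_eq m hj, i.2, dif_pos] using h

/-- The points of a valid certificate approximate the pseudospectrum of all instances whose answers
are compatible with the certificate. -/
theorem IsValid.points_spec (hc : c.IsValid n k)
    (ha : InBox c.box fun i => D.eval ε (EvalIndex.ofNat i)) :
    (∀ w ∈ c.points, ratPoint w ∈ pseudospectrum H.op ε) ∧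
      ∀ z ∈ pseudospectrum H.op ε, ∃ w ∈ c.points, dist z (ratPoint w) ≤ (2 : ℝ) ^ (-(k : ℤ)) := by
  obtain ⟨L, R, B, q, K, M, hR, hRL, hθ, hpos, hN0, hNL, hP0, hPL, hM₁, hM₂, hq, hin, hout⟩ := hc
  have hrel : ∀ e ∈ relevantIndices n L B, |D.eval ε e - c.approx e| ≤ c.error := by
    intro e he
    have := abs_sub_approx_le ha (hpos e he)
    rwa [EvalIndex.ofNat_position] at this
  have hnat : ∀ e ∈ relevantIndices n L B, ∀ N : ℕ, D.eval ε e = N →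
      natValue (c.approx e) = N := by
    intro e he N hN
    refine natValue_eq ?_
    rw [abs_sub_comm, ← hN]
    exact (hrel e he).trans_lt (by linarith)
  have hB0 : D.numPatches 0 ≤ B := by
    rwa [hnat (.numPatches 0) (by simp [relevantIndices]) _ rfl] at hN0
  have hBL : D.numPatches L ≤ B := by
    rwa [hnat (.numPatches L) (by simp [relevantIndices]) _ rfl] at hNL
  have happ : D.Approximates c.approx L B c.error := by
    refine approximates hθ hrel hBL fun m => ?_
    have hm := m.2.trans_le hBL
    have := hPL m hm
    rwa [hnat (.numPoints L m) (numPoints_mem_relevantIndices (.inr rfl) hm) (D.numPoints L m)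
      (by simp [DiscreteOperator.LocalData.eval])] at this
  have hdom : D.Dominated q K M := by
    refine ⟨fun m => ?_, ?_, ?_, ?_⟩
    · have hm := m.2.trans_le hB0
      have := hP0 m hm
      rwa [hnat (.numPoints 0 m) (numPoints_mem_relevantIndices (.inl rfl) hm) (D.numPoints 0 m)
        (by simp [DiscreteOperator.LocalData.eval])] at this
    · have := (abs_le.1 (hrel .normBound (by simp [relevantIndices]))).2
      simp only [DiscreteOperator.LocalData.eval] at this
      linarith
    · have := (abs_le.1 (hrel .decayConst (by simp [relevantIndices]))).2
      simp only [DiscreteOperator.LocalData.eval] at this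
      linarith
    · have := (abs_le.1 (hrel .decayExp (by simp [relevantIndices]))).1
      simp only [DiscreteOperator.LocalData.eval] at this
      linarith
  have hε := abs_le.1 (hrel .level (by simp [relevantIndices]))
  simp only [DiscreteOperator.LocalData.eval] at hε
  have hθ0 := c.error_pos
  refine ⟨fun w hw => ?_, fun z hz => ?_⟩
  · by_contra hw'
    have hlt : ε < lowerNorm H.op (ratPoint w) := not_le.1 hw'
    refine hin w hw (happ.patchBound hdom R ?_)
    linarith [hε.1]
  · refine (hout z).resolve_left fun hz' => ?_
    have h₁ := happ.le_lowerNorm hdom hR hRL hz'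
    have h₂ : lowerNorm H.op z ≤ ε := hz
    linarith [hε.2]

/-- Every instance is compatible with a valid certificate. -/
theorem exists_isValid (D : H.LocalData) (hε : 0 < ε) (k : ℕ) :
    ∃ c : Certificate, c.IsValid n k ∧ InBox c.box fun i => D.eval ε (EvalIndex.ofNat i) := by
  have := H.nontrivial_space
  obtain ⟨β, hβ, v, hv, hnet⟩ := exists_inner_net H.op hε
    (show (0 : ℝ) < (2 : ℝ) ^ (-(k : ℤ)) by positivity)
  obtain ⟨q, hq⟩ := exists_nat_one_div_lt D.decayExp_pos
  obtain ⟨M, hM⟩ := exists_nat_ge (max D.normBound D.decayConst + 1)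
  set K := Finset.univ.sup (D.numPoints 0) with hK
  obtain ⟨R, hRβ, hR⟩ := (((tendsto_schurBound_cubeWeight n q K M).eventually
    (gt_mem_nhds (show (0 : ℝ) < β / 8 by positivity))).and (eventually_gt_atTop 0)).exists
  obtain ⟨L, hLβ, hRL⟩ := (((tendsto_schurBound_tailWeight n q K M (R + 1 : ℕ)).eventually
    (gt_mem_nhds (show (0 : ℝ) < β / 8 by positivity))).and (eventually_ge_atTop R)).exists
  set B := D.numPatches 0 + D.numPatches L + Finset.univ.sup (D.numPoints L) with hB
  -- The error `θ = 1 / (t + 1)` of the answers is so small that the two localization errors, the two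
  -- terms `2 * B ^ 2 * θ` and a few multiples of `θ` add up to at most `β`.
  obtain ⟨t, ht⟩ := exists_nat_one_div_lt (show (0 : ℝ) < min (1 / 4)
    (min (β / (16 * ((B : ℝ) ^ 2 + 1))) ((D.decayExp - 1 / ((q : ℝ) + 1)) / 2)) from
      lt_min (by norm_num) (lt_min (by positivity) (by linarith)))
  obtain ⟨N, hN⟩ : ∃ N, ∀ e ∈ relevantIndices n L B, e.position < N := by
    refine ⟨((relevantIndices n L B).map EvalIndex.position).sum + 1, fun e he => ?_⟩
    exact Nat.lt_succ_of_le (List.single_le_sum (fun _ _ => Nat.zero_le _) _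
      (List.mem_map_of_mem he))
  have hrat : ∀ i, ∃ r : ℚ, D.eval ε (EvalIndex.ofNat i) - 1 / ((t : ℝ) + 1) < r ∧
      (r : ℝ) < D.eval ε (EvalIndex.ofNat i) + 1 / ((t : ℝ) + 1) := fun i =>
    exists_rat_btwn (by have : (0 : ℝ) < 1 / ((t : ℝ) + 1) := by positivity
                        linarith)
  choose r hr₁ hr₂ using hrat
  let c : Certificate := ⟨(List.range N).map r, t, v.toList⟩
  have hθ : c.error = 1 / ((t : ℝ) + 1) := rfl
  have hbox : InBox c.box fun i => D.eval ε (EvalIndex.ofNat i) := by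
    intro i hi
    simp only [box, hθ, c, List.getElem_map, List.getElem_range]
    constructor <;> linarith [hr₁ i, hr₂ i]
  refine ⟨c, ?_, hbox⟩
  have hlen : c.answers.length = N := by simp [c]
  rw [← hθ] at ht
  have hθ0 := c.error_pos
  have hθ₁ : c.error ≤ 1 / 4 := (ht.trans_le (min_le_left _ _)).le
  have hθ₂ : c.error ≤ β / (16 * ((B : ℝ) ^ 2 + 1)) :=
    (ht.trans_le ((min_le_right _ _).trans (min_le_left _ _))).le
  have hθ₃ : c.error ≤ (D.decayExp - 1 / ((q : ℝ) + 1)) / 2 :=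
    (ht.trans_le ((min_le_right _ _).trans (min_le_right _ _))).le
  have hθ₄ : 16 * ((B : ℝ) ^ 2 * c.error) + 16 * c.error ≤ β := by
    rw [le_div_iff₀ (by positivity)] at hθ₂
    linarith
  have hBθ : 0 ≤ (B : ℝ) ^ 2 * c.error := by positivity
  have hrel : ∀ e ∈ relevantIndices n L B, |D.eval ε e - c.approx e| ≤ c.error := by
    intro e he
    have := abs_sub_approx_le hbox (by rw [hlen]; exact hN e he)
    rwa [EvalIndex.ofNat_position] at this
  have hnat : ∀ e ∈ relevantIndices n L B, ∀ N : ℕ, D.eval ε e = N →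
      natValue (c.approx e) = N := by
    intro e he N hN
    refine natValue_eq ?_
    rw [abs_sub_comm, ← hN]
    exact (hrel e he).trans_lt (by linarith)
  have hPK : ∀ m, D.numPoints 0 m ≤ K := fun m => Finset.le_sup (Finset.mem_univ m)
  have hPB : ∀ m, D.numPoints L m ≤ B := fun m =>
    (Finset.le_sup (f := D.numPoints L) (Finset.mem_univ m)).trans (by omega)
  have happ : D.Approximates c.approx L B c.error :=
    approximates hθ₁ hrel (by omega) hPB
  have hM₁ : D.normBound + 1 ≤ M := by linarith [le_max_left D.normBound D.decayConst]
  have hM₂ : D.decayConst + 1 ≤ M := by linarith [le_max_right D.normBound D.decayConst]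
  have hdom : D.Dominated q K M := ⟨hPK, by linarith, by linarith, hq.le⟩
  have hε' := abs_le.1 (hrel .level (by simp [relevantIndices]))
  simp only [DiscreteOperator.LocalData.eval] at hε'
  refine ⟨L, R, B, q, K, M, hR, hRL, hθ₁, fun e he => by rw [hlen]; exact hN e he, ?_, ?_, ?_, ?_,
    ?_, ?_, ?_, fun w hw hb => ?_, fun z => ?_⟩
  · rw [hnat (.numPatches 0) (by simp [relevantIndices]) _ rfl]; omega
  · rw [hnat (.numPatches L) (by simp [relevantIndices]) _ rfl]; omega
  · intro m hm
    by_cases h : m < D.numPatches 0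
    · rw [hnat (.numPoints 0 m) (numPoints_mem_relevantIndices (.inl rfl) hm) (D.numPoints 0 ⟨m, h⟩)
        (by simp [DiscreteOperator.LocalData.eval, h])]
      exact hPK _
    · rw [hnat (.numPoints 0 m) (numPoints_mem_relevantIndices (.inl rfl) hm) 0
        (by simp [DiscreteOperator.LocalData.eval, h])]
      exact Nat.zero_le _
  · intro m hm
    by_cases h : m < D.numPatches L
    · rw [hnat (.numPoints L m) (numPoints_mem_relevantIndices (.inr rfl) hm) (D.numPoints L ⟨m, h⟩)
        (by simp [DiscreteOperator.LocalData.eval, h])]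
      exact hPB _
    · rw [hnat (.numPoints L m) (numPoints_mem_relevantIndices (.inr rfl) hm) 0
        (by simp [DiscreteOperator.LocalData.eval, h])]
      exact Nat.zero_le _
  · have := (abs_le.1 (hrel .normBound (by simp [relevantIndices]))).1
    simp only [DiscreteOperator.LocalData.eval] at this
    linarith
  · have := (abs_le.1 (hrel .decayConst (by simp [relevantIndices]))).1
    simp only [DiscreteOperator.LocalData.eval] at this
    linarith
  · have := (abs_le.1 (hrel .decayExp (by simp [relevantIndices]))).2
    simp only [DiscreteOperator.LocalData.eval] at this
    linarith
  · have h₁ := happ.le_lowerNorm hdom hR hRL hb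
    have h₂ := hv w (by simpa [c] using hw)
    linarith [hε'.1, hε'.2]
  · rcases le_or_gt (lowerNorm H.op z) (ε + β) with hz | hz
    · right
      obtain ⟨w, hw, hzw⟩ := hnet z hz
      exact ⟨w, by simpa [c] using hw, hzw⟩
    · left
      have h₁ := happ.patchBound hdom R hz.le
      intro m hm
      have h₂ : c.approx .level + 2 * c.error + (schurBound n q K M (cubeWeight n R) +
          B ^ 2 * (2 * c.error)) ≤ ε + β - (schurBound n q K M
          (tailWeight (n := n) (L - (R + 1 : ℕ))) + B ^ 2 * (2 * c.error)) := by
        linarith [hε'.1, hε'.2]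
      exact ⟨(h₁ m hm).1.mono h₂, (h₁ m hm).2.mono h₂⟩

end Certificate

end

theorem theorem3 (n : ℕ)
    (Λ : ∀ H : DiscreteOperator.{u} n, H.IsFLC → H.IsShortRange → H.LocalData) (k : ℕ) :
    ∃ (Γ : BSSAlgorithm) (g : PseudospectralInstance.{u} n → NonemptyCompacts ℂ),
      Γ.Computes (flcPseudospectralProblem n Λ) finiteSets g ∧
      ∀ A : PseudospectralInstance.{u} n,
        dist (g A) ((flcPseudospectralProblem n Λ).Ξ A) ≤ (2 : ℝ) ^ (-(k : ℤ)) := by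
  let κ := {c : Certificate // c.IsValid n k}
  let _ : Encodable κ := Encodable.ofCountable κ
  obtain ⟨g, hg, hgA⟩ := searchAlgorithm_computes (fun c : κ => c.1.box) (fun c => c.1.output)
    (flcPseudospectralProblem n Λ) finiteSets (fun c => c.1.even_length_output) fun A => by
      obtain ⟨c, hc, hbox⟩ := Certificate.exists_isValid (Λ A.H A.flc A.shortRange) A.ε_pos k
      exact ⟨⟨c, hc⟩, hbox⟩
  refine ⟨_, g, hg, fun A => ?_⟩
  obtain ⟨⟨c, hc⟩, hbox, hgc⟩ := hgA A
  obtain ⟨h₁, h₂⟩ := hc.points_spec hbox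
  have := A.H.nontrivial_space
  have hne : ((pointsOfList c.output : Finset ℂ) : Set ℂ).Nonempty := by
    obtain ⟨z, hz⟩ := pseudospectrum_nonempty A.H.op A.ε_pos
    obtain ⟨w, hw, -⟩ := h₂ z hz
    exact ⟨ratPoint w, (c.mem_pointsOfList_output _).2 ⟨w, hw, rfl⟩⟩
  have hcoe : (g A : Set ℂ) = pointsOfList c.output := by
    rw [hgc]
    simp only [finiteSets, dif_pos hne]
    rfl
  rw [Metric.NonemptyCompacts.dist_eq, hcoe]
  refine Metric.hausdorffDist_le_of_mem_dist (by positivity) (fun z hz => ?_) fun z hz => ?_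
  · obtain ⟨w, hw, rfl⟩ := (c.mem_pointsOfList_output z).1 hz
    exact ⟨ratPoint w, h₁ w hw, by rw [dist_self]; positivity⟩
  · obtain ⟨w, hw, hzw⟩ := h₂ z hz
    exact ⟨ratPoint w, (c.mem_pointsOfList_output _).2 ⟨w, hw, rfl⟩, hzw⟩
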